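/- **Setting.** Let $\mathcal P_8$ be the regular octahedron with edges of length $1$ and with faces $F_1,\dots,F_8$, named so that its six vertices are incident to the faces with indices $\{1,4,6,7\}$, $\{1,2,5,6\}$, $\{1,2,3,4\}$, $\{2,3,5,8\}$, $\{3,4,7,8\}$, $\{5,6,7,8\}$, and so that $F_2,F_4,F_6$ occur in this clockwise order around $F_1$ for a viewer outside. A *net* is obtained by keeping the faces glued along the edges of a spanning tree of the face-adjacency graph (the *dual graph* of the net) and unfolding them into the plane without overlap. A *landscape* is the union of the faces on a path with at least two vertices in the dual graph of a net; the path is its dual graph, landscapes are identified with these (undirected) paths, and the landscape is said to go from one end of the path to the other. A *sublandscape* is given by a subpath with at least two vertices. An *orientation* of a landscape $L$ is an unfolding of $L$ into $\mathbb R^2$ which is isometric on each face, keeps consecutive faces glued along their common edge, shows the exterior sides, and puts an edge of some face of $L$ on the segment from $(0,0)$ to $(1,0)$ with that face in the upper half-plane. For points $p,q$ of $L$, $|T_L(p,q)|$ is the length of the segment joining the images of $p$ and $q$ in an orientation of $L$ if this segment lies in the image of $L$, and $\infty$ otherwise (if $p$ or $q$ has several images because it lies on a cut edge, the shortest admissible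 segment is taken). The points $p,q\in L$ *witness the validity* of $L$ if for every other landscape $L'$ containing $p$ and $q$ one has $|T_L(p,q)|\le|T_{L'}(p,q)|$, and in case of equality $L'$ is not a sublandscape of $L$. $L$ is *valid* if such points exist. An *admissible labelling* is a permutation $n_1,\dots,n_8$ of $1,\dots,8$ such that $F_{n_2},F_{n_4},F_{n_6}$ occur around $F_{n_1}$ in the same clockwise order as $F_2,F_4,F_6$ around $F_1$, and $F_{n_b},F_{n_c}$ are opposite whenever $b+c=9$. A point has the representation $(F_n,F_m,x,y)$ if it lies in $F_n$, the face $F_m$ is adjacent to $F_n$, and the point has coordinates $(x,y)$ when $F_n$ is placed, exterior side towards the viewer, in the upper half-plane with the edge shared with $F_m$ on the segment from $(0,0)$ to $(1,0)$. **Corollary.** For every admissible labelling, let $L_1,\dots,L_9$ be the landscapes with the sequences of faces (writing $b$ for $F_{n_b}$) $$L_1:1,2;\quad L_2:1,2,5;\quad L_3:1,6,5;\quad L_4:1,6,5,8;\quad L_5:1,2,3,8;$$ $$L_6:1,4,7,8;\quad L_7:1,6,7,8;\quad L_8:1,2,5,8;\quad L_9:1,4,3,8.$$ These nine landscapes are distinct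 and valid, and their validity is witnessed by the points with the following representations: - $L_1$: $(F_{n_1},F_{n_2},0.5,0.2)$ and $(F_{n_2},F_{n_1},0.5,0.2)$ - $L_2$: $(F_{n_1},F_{n_2},0.5,0.1)$ and $(F_{n_5},F_{n_6},0.8,0.1)$ - $L_3$: $(F_{n_1},F_{n_2},0.8,0.1)$ and $(F_{n_5},F_{n_6},0.5,0.1)$ - $L_4$: $(F_{n_1},F_{n_2},0.9,\frac16)$ and $(F_{n_8},F_{n_7},0.9,\frac16)$ - $L_5$: $(F_{n_1},F_{n_2},0.1,0.1)$ and $(F_{n_8},F_{n_7},0.4,\frac23)$ - $L_6$: $(F_{n_1},F_{n_2},0.4,\frac23)$ and $(F_{n_8},F_{n_7},0.1,0.1)$ - $L_7$: $(F_{n_1},F_{n_2},0.6,\frac23)$ and $(F_{n_8},F_{n_7},0.9,0.1)$ - $L_8$: $(F_{n_1},F_{n_2},0.9,0.1)$ and $(F_{n_8},F_{n_7},0.6,\frac23)$ - $L_9$: $(F_{n_1},F_{n_2},0.1,\frac16)$ and $(F_{n_8},F_{n_7},0.1,\frac16)$ The only valid landscape from $F_{n_1}$ to $F_{n_2}$ is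 $L_1$; those from $F_{n_1}$ to $F_{n_5}$ are exactly $L_2,L_3$; those from $F_{n_1}$ to $F_{n_8}$ are exactly $L_4,\dots,L_9$; so there are exactly nine valid landscapes from $F_{n_1}$ to $F_{n_2}$, $F_{n_5}$ or $F_{n_8}$. Up to the labelling there are no others: every valid landscape with origin face $F$ is one of $L_1,\dots,L_9$ for some admissible labelling with $F_{n_1}=F$. -/

import Mathlib

open scoped ENNReal

namespace Octahedron

/-- The eight faces of the octahedron. -/
inductive Face : Type
  | F1 | F2 | F3 | F4 | F5 | F6 | F7 | F8
  deriving DecidableEq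

open Face

instance : Fintype Face :=
  ⟨{F1, F2, F3, F4, F5, F6, F7, F8}, fun f => by cases f <;> decide⟩

/-- The space containing the octahedron. -/
abbrev Space : Type := EuclideanSpace ℝ (Fin 3)

/-- The plane in which landscapes are unfolded. -/
abbrev Plane : Type := EuclideanSpace ℝ (Fin 2)

/-- An outward normal vector of each face of the regular octahedron with vertices `± e_i / √2`.
The three vertices of the face `f` are `(normal f i) * e_i / √2`, `i = 0, 1, 2`. Naming a vertex by
the set of the indices of the four faces that contain it, one has
`+e₀ ~ {1,2,3,4}`, `-e₀ ~ {5,6,7,8}`, `+e₁ ~ {1,2,5,6}`, `-e₁ ~ {3,4,7,8}`,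
`+e₂ ~ {1,4,6,7}`, `-e₂ ~ {2,3,5,8}`. -/
def normal : Face → Fin 3 → ℤ
  | F1 => ![1, 1, 1]
  | F2 => ![1, 1, -1]
  | F3 => ![1, -1, -1]
  | F4 => ![1, -1, 1]
  | F5 => ![-1, 1, -1]
  | F6 => ![-1, 1, 1]
  | F7 => ![-1, -1, 1]
  | F8 => ![-1, -1, -1]

/-- The `i`-th vertex of the face `f` of the regular octahedron with edges of length `1`. -/
noncomputable def vertex (f : Face) (i : Fin 3) : Space :=
  EuclideanSpace.single i ((normal f i : ℝ) / √2)

/-- The points of the face `f`: a closed triangle in space. -/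
noncomputable def region (f : Face) : Set Space := convexHull ℝ (Set.range (vertex f))

/-- Two faces are adjacent when they share an edge, that is, exactly two vertices. -/
def faceGraph : SimpleGraph Face where
  Adj f g := (Finset.univ.filter fun i => normal f i = normal g i).card = 2
  symm := ⟨fun f g h => by simpa only [eq_comm] using h⟩
  loopless := ⟨fun f h => by simp at h⟩

/-- Two faces are opposite when they have no common vertex. -/
def IsOpposite (f g : Face) : Prop := ∀ i, normal f i ≠ normal g i

/-- The faces `a`, `b`, `c` are the three neighbours of `f`, and occur in this clockwise order
around `f` for a viewer outside the octahedron. -/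
def IsClockwise (f a b c : Face) : Prop :=
  faceGraph.Adj f a ∧ faceGraph.Adj f b ∧ faceGraph.Adj f c ∧
    (Matrix.of ![normal a, normal b, normal c]).det < 0

/-- An admissible labelling `F_{n_1}, …, F_{n_8}` of the faces: `F_{n_2}, F_{n_4}, F_{n_6}` occur
around `F_{n_1}` in the same clockwise order as `F_2, F_4, F_6` around `F_1`, and
`F_{n_b}`, `F_{n_c}` are opposite when `b + c = 9`. Here `n F_b` stands for `F_{n_b}`. -/
structure IsLabelling (n : Equiv.Perm Face) : Prop where
  clockwise : IsClockwise (n F1) (n F2) (n F4) (n F6)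
  opp18 : IsOpposite (n F1) (n F8)
  opp27 : IsOpposite (n F2) (n F7)
  opp36 : IsOpposite (n F3) (n F6)
  opp45 : IsOpposite (n F4) (n F5)

/-! ### Placing faces in the plane -/

/-- Twice the signed area of the triangle `t 0, t 1, t 2`; positive if it is counterclockwise. -/
noncomputable def signedArea (t : Fin 3 → Plane) : ℝ :=
  (t 1 0 - t 0 0) * (t 2 1 - t 0 1) - (t 1 1 - t 0 1) * (t 2 0 - t 0 0)

/-- `t` is a congruent copy of the face `f` in the plane with the exterior side of `f` facing the
viewer; `t i` is the image of `vertex f i`. (Seen from outside, the vertices `0, 1, 2` of `f` are in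
counterclockwise order if and only if the product of the signs `normal f i` is positive.) -/
structure IsPlacement (f : Face) (t : Fin 3 → Plane) : Prop where
  unit : ∀ i j, i ≠ j → dist (t i) (t j) = 1
  exterior_up : 0 < ((∏ i, normal f i : ℤ) : ℝ) * signedArea t

/-- The edge shared by `f` and `g` is mapped to the segment from `(0,0)` to `(1,0)`, and the
remaining vertex of `f` to the upper half-plane. -/
def IsBased (f g : Face) (t : Fin 3 → Plane) : Prop :=
  (∀ i, normal f i = normal g i → t i = !₂[0, 0] ∨ t i = !₂[1, 0]) ∧
    ∀ i, normal f i ≠ normal g i → 0 < t i 1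

/-- The map from the face `f` to the plane which is affine on `f` and maps `vertex f i` to `t i`:
`√2 * normal f i * p i` is the `i`-th barycentric coordinate of a point `p` of `f`. -/
noncomputable def place (f : Face) (t : Fin 3 → Plane) (p : Space) : Plane :=
  ∑ i, (√2 * (normal f i : ℝ) * p i) • t i

theorem normal_mul_self (f : Face) (i : Fin 3) : (normal f i : ℝ) * normal f i = 1 := by
  have h : ∀ (f : Face) (i : Fin 3), normal f i * normal f i = 1 := by decide
  exact_mod_cast h f i

theorem place_vertex (f : Face) (t : Fin 3 → Plane) (i : Fin 3) : place f t (vertex f i) = t i := by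
  have h := normal_mul_self f
  have h2 := Real.mul_self_sqrt (show (0:ℝ) ≤ 2 by norm_num)
  unfold place
  rw [Finset.sum_eq_single i]
  · simp only [vertex, PiLp.single_apply, if_true]
    have : √2 * (normal f i : ℝ) * ((normal f i : ℝ) / √2) = 1 := by
      field_simp; nlinarith [h i]
    rw [this, one_smul]
  · intro j _ hj; simp [vertex, hj]
  · simp

/-- The barycentric coordinates of a point of a face add up to `1`. -/
theorem region_sum {f : Face} {p : Space} (hp : p ∈ region f) : ∑ i, √2 * (normal f i : ℝ) * p i = 1 := by
  have hc : Convex ℝ {p : Space | ∑ i, √2 * (normal f i : ℝ) * p i = 1} := by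
    intro a ha b hb x y hx hy hxy
    simp only [Set.mem_ofPred_eq, Fin.sum_univ_three, PiLp.add_apply, PiLp.smul_apply, smul_eq_mul] at *
    linear_combination x * ha + y * hb + hxy
  refine convexHull_min ?_ hc hp
  rintro _ ⟨i, rfl⟩
  have h := normal_mul_self f i
  simp only [Set.mem_ofPred_eq, vertex, PiLp.single_apply]
  rw [Finset.sum_eq_single i]
  · simp; field_simp; nlinarith
  · intro j _ hj; simp [hj]
  · simp

/-- A placement of a face in the plane preserves distances between points of the face. -/
theorem place_dist {f : Face} {t : Fin 3 → Plane} (ht : IsPlacement f t) {p q : Space} (hp : p ∈ region f)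
    (hq : q ∈ region f) : dist (place f t p) (place f t q) = dist p q := by
  have h := normal_mul_self f
  have h2 := Real.mul_self_sqrt (show (0:ℝ) ≤ 2 by norm_num)
  have e01 := ht.unit 0 1 (by decide)
  have e02 := ht.unit 0 2 (by decide)
  have e12 := ht.unit 1 2 (by decide)
  have sp := region_sum hp
  have sq := region_sum hq
  rw [EuclideanSpace.dist_eq, Real.sqrt_eq_one] at e01 e02 e12
  rw [EuclideanSpace.dist_eq, EuclideanSpace.dist_eq]
  congr 1
  simp only [Fin.sum_univ_three, Fin.sum_univ_two, Real.dist_eq, sq_abs, place, PiLp.add_apply, PiLp.smul_apply, smul_eq_mul] at *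
  have a0 := h 0
  have a1 := h 1
  have a2 := h 2
  obtain ⟨c0, hc0⟩ : ∃ c, c = √2 * (normal f 0 : ℝ) * (p 0 - q 0) := ⟨_, rfl⟩
  obtain ⟨c1, hc1⟩ : ∃ c, c = √2 * (normal f 1 : ℝ) * (p 1 - q 1) := ⟨_, rfl⟩
  obtain ⟨c2, hc2⟩ : ∃ c, c = √2 * (normal f 2 : ℝ) * (p 2 - q 2) := ⟨_, rfl⟩
  have k0 : (p 0 - q 0)^2 = c0^2/2 := by
    rw [hc0]; linear_combination (-(normal f 0:ℝ)^2 * (p 0 - q 0)^2/2) * h2 - (p 0 - q 0)^2 * a0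
  have k1 : (p 1 - q 1)^2 = c1^2/2 := by
    rw [hc1]; linear_combination (-(normal f 1:ℝ)^2 * (p 1 - q 1)^2/2) * h2 - (p 1 - q 1)^2 * a1
  have k2 : (p 2 - q 2)^2 = c2^2/2 := by
    rw [hc2]; linear_combination (-(normal f 2:ℝ)^2 * (p 2 - q 2)^2/2) * h2 - (p 2 - q 2)^2 * a2
  have s : c2 = -c0 - c1 := by rw [hc0, hc1, hc2]; linear_combination sp - sq
  rw [k0, k1, k2]
  trans (c0 * t 0 0 + c1 * t 1 0 + c2 * t 2 0)^2 + (c0 * t 0 1 + c1 * t 1 1 + c2 * t 2 1)^2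
  · rw [hc0, hc1, hc2]; ring
  · rw [s]
    linear_combination -c0*c1 * e01 + c0*(c0+c1) * e02 + c1*(c0+c1) * e12

/-- The point `p` has the representation `(f, g, x, y)`: home-face `f`, shared-face `g`,
coordinates `x` and `y`. -/
def IsRepresentation (p : Space) (f g : Face) (x y : ℝ) : Prop :=
  faceGraph.Adj f g ∧ p ∈ region f ∧
    ∃ t : Fin 3 → Plane, IsPlacement f t ∧ IsBased f g t ∧ place f t p = !₂[x, y]

/-! ### Orientations, nets and landscapes -/

/-- Collections of faces together with gluings along some of the shared edges. Nets and
landscapes are given by their dual graphs, which are of this kind. -/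
abbrev DualGraph : Type := faceGraph.Subgraph

/-- `t` unfolds the faces of `H` into the plane, exterior sides facing the viewer, in such a way
that faces adjacent in `H` stay glued along their shared edge; and the face `f` of `H` is mapped to
the upper half-plane, with the edge it shares with `g` mapped to the segment from `(0,0)` to
`(1,0)`. -/
structure IsOrientation (H : DualGraph) (f g : Face) (t : Face → Fin 3 → Plane) : Prop where
  mem : f ∈ H.verts
  adj : faceGraph.Adj f g
  based : IsBased f g (t f)
  placement : ∀ k ∈ H.verts, IsPlacement k (t k)
  glue : ∀ k l, H.Adj k l → ∀ i, normal k i = normal l i → t k i = t l i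

/-- `N` is the dual graph of a net: all faces are glued along the edges of a spanning tree, and
they unfold into the plane without overlap. -/
def IsNet (N : DualGraph) : Prop :=
  N.IsSpanning ∧ N.spanningCoe.IsTree ∧
    ∃ f g t, IsOrientation N f g t ∧
      ∀ k l, k ≠ l → Disjoint (interior (convexHull ℝ (Set.range (t k))))
        (interior (convexHull ℝ (Set.range (t l))))

/-- The graph with the faces in the list `l` as vertices, in which faces that are adjacent and
consecutive in `l` are joined. -/
def pathGraph (l : List Face) : DualGraph where
  verts := {f | f ∈ l}
  Adj f g := faceGraph.Adj f g ∧ ([f, g] <:+: l ∨ [g, f] <:+: l)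
  adj_sub h := h.1
  edge_vert := by
    rintro f g ⟨-, h | h⟩
    · exact h.subset (by simp)
    · exact h.subset (by simp)
  symm := ⟨fun _ _ h => ⟨h.1.symm, h.2.symm⟩⟩

/-- `H` is (the dual graph of) a landscape from the origin face `u` to the destination face `v`:
a path with at least two vertices and ends `u`, `v` in the dual graph of a net. -/
def IsLandscapeFromTo (H : DualGraph) (u v : Face) : Prop :=
  (∃ l : List Face, l.Nodup ∧ l.IsChain faceGraph.Adj ∧ 2 ≤ l.length ∧
      l.head? = some u ∧ l.getLast? = some v ∧ H = pathGraph l) ∧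
    ∃ N, IsNet N ∧ H ≤ N

/-- `H` is (the dual graph of) a landscape. For landscapes, `K ≤ H` says that `K` is a
sublandscape of `H`. -/
def IsLandscape (H : DualGraph) : Prop := ∃ u v, IsLandscapeFromTo H u v

/-- The points of the octahedron that lie in a face of `H`. -/
def points (H : DualGraph) : Set Space := ⋃ f ∈ H.verts, region f

/-- The image of `H` in the plane under the unfolding `t`. -/
def image (H : DualGraph) (t : Face → Fin 3 → Plane) : Set Plane :=
  ⋃ f ∈ H.verts, place f (t f) '' region f

/-- The length `|T_H(p, q)|` of the trail from `p` to `q` in `H`: the length of the segment joining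
images of `p` and `q` in an orientation of `H`, if this segment is contained in the orientation; it
is `∞` if there is no such segment. (A point on an edge of the octahedron which is cut in `H` can
have several images; the shortest segment counts. The choice of the orientation of `H` does not
matter.) -/
noncomputable def trailLength (H : DualGraph) (p q : Space) : ℝ≥0∞ :=
  sInf {d | ∃ f g t, IsOrientation H f g t ∧
    ∃ k ∈ H.verts, ∃ l ∈ H.verts, p ∈ region k ∧ q ∈ region l ∧
      segment ℝ (place k (t k) p) (place l (t l) q) ⊆ image H t ∧
      d = edist (place k (t k) p) (place l (t l) q)}

/-- The points `p` and `q` witness that the landscape `H` is valid. -/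
def Witnesses (H : DualGraph) (p q : Space) : Prop :=
  p ∈ points H ∧ q ∈ points H ∧
    ∀ K, IsLandscape K → K ≠ H → p ∈ points K → q ∈ points K →
      trailLength H p q ≤ trailLength K p q ∧
        (trailLength H p q = trailLength K p q → ¬ K ≤ H)

/-- `H` is a valid landscape. -/
def IsValid (H : DualGraph) : Prop := IsLandscape H ∧ ∃ p q, Witnesses H p q

/-! ### The nine landscapes -/

/-- The sequences of faces of the landscapes `L_1, …, L_9`; the index `a : Fin 9` stands
for `L_{a+1}`. -/
def faces : Fin 9 → List Face :=
  ![[F1, F2],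
    [F1, F2, F5],
    [F1, F6, F5],
    [F1, F6, F5, F8],
    [F1, F2, F3, F8],
    [F1, F4, F7, F8],
    [F1, F6, F7, F8],
    [F1, F2, F5, F8],
    [F1, F4, F3, F8]]

/-- The landscape `L_{a+1}` with respect to the labelling `n`. -/
def landscape (n : Equiv.Perm Face) (a : Fin 9) : DualGraph := pathGraph ((faces a).map n)

/-- Home-face, shared-face and coordinates of the first of the two points given for
`L_{a+1}`. -/
noncomputable def firstPoint : Fin 9 → Face × Face × ℝ × ℝ :=
  ![(F1, F2, 0.5, 0.2),
    (F1, F2, 0.5, 0.1),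
    (F1, F2, 0.8, 0.1),
    (F1, F2, 0.9, 1 / 6),
    (F1, F2, 0.1, 0.1),
    (F1, F2, 0.4, 2 / 3),
    (F1, F2, 0.6, 2 / 3),
    (F1, F2, 0.9, 0.1),
    (F1, F2, 0.1, 1 / 6)]

/-- Home-face, shared-face and coordinates of the second of the two points given for
`L_{a+1}`. -/
noncomputable def secondPoint : Fin 9 → Face × Face × ℝ × ℝ :=
  ![(F2, F1, 0.5, 0.2),
    (F5, F6, 0.8, 0.1),
    (F5, F6, 0.5, 0.1),
    (F8, F7, 0.9, 1 / 6),
    (F8, F7, 0.4, 2 / 3),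
    (F8, F7, 0.1, 0.1),
    (F8, F7, 0.9, 0.1),
    (F8, F7, 0.6, 2 / 3),
    (F8, F7, 0.1, 1 / 6)]

/-- With respect to the labelling `n`, the point `p` has the representation
`(F_{n_b}, F_{n_c}, x, y)`, where `r = (F_b, F_c, x, y)`. -/
def HasRepresentation (n : Equiv.Perm Face) (p : Space) (r : Face × Face × ℝ × ℝ) : Prop :=
  IsRepresentation p (n r.1) (n r.2.1) r.2.2.1 r.2.2.2

end Octahedron

open Octahedron

/-!
A face of the octahedron is a vector of three signs, and crossing an edge changes one of the signs.
So a path in the dual graph is given by its first face and a word in the three coordinates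
(`walk`), and a face is unfolded along a path by rolling an equilateral triangle as the word
prescribes (`unfold`), whatever the first face is.

Let `p` and `q` be points of the first and the last face of a path, with barycentric coordinates
`c` and `d`. In the unfolding, the squared distance of `p` and `q` is the sum of
`c i * d j * |P i - Q j| ^ 2` over the vertices `P i` and `Q j` of the two triangles, minus a
quantity which does not depend on the path (`dist_sq_unfold`). The numbers `|P i - Q j| ^ 2` are
integers. Hence two paths with the same ends can be compared through two `3 × 3` tables of integers.
There are 111 words of simple paths, and the tables show that a word with a repeated letter never
gives a smaller distance than a suitable word with the same ends and without repeated letters; the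
distance is strictly larger unless `p` lies on the first edge crossed or `q` on the last one
(`exists_dominated`, `exists_meanSq_lt`).

A path without repeated letters has at most four faces, and they unfold to a convex strip
(`covered_of_nodup`), so that its trails are the straight segments between images of points. If `p`
lies on the first edge crossed, or `q` on the last one, the path can be shortened. By induction, a
landscape whose word has a repeated letter always has a competitor which is shorter or is one of
its parts (`exists_competitor`); so it is not valid (`nodup_of_witnesses`). Conversely, a path
without repeated letters is part of a net (`isNet_pathGraph`), and at the points of the theorem it
has a shorter chord than all other paths between the two faces: numerically for words without
repeated letters (`meanSq_word_lt`), and by the comparison above for the other words.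

An admissible labelling amounts to the face `F_{n_1}` and a permutation of the coordinates that
respects the orientation (`IsLabelling.exists_relabel`), and it carries the words `word a` to the
words without repeated letters.
-/

namespace Octahedron
open Face

/-! ### Faces, paths and words -/

instance : DecidableRel faceGraph.Adj := fun f g =>
  inferInstanceAs (Decidable ((Finset.univ.filter fun i => normal f i = normal g i).card = 2))

/-- The face on the other side of the edge of `f` which is opposite to the `i`-th vertex. Its normal
vector differs from that of `f` in the sign of the `i`-th coordinate. -/
def across : Fin 3 → Face → Face
  | 0, F1 => F6 | 0, F2 => F5 | 0, F3 => F8 | 0, F4 => F7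
  | 0, F5 => F2 | 0, F6 => F1 | 0, F7 => F4 | 0, F8 => F3
  | 1, F1 => F4 | 1, F2 => F3 | 1, F3 => F2 | 1, F4 => F1
  | 1, F5 => F8 | 1, F6 => F7 | 1, F7 => F6 | 1, F8 => F5
  | 2, F1 => F2 | 2, F2 => F1 | 2, F3 => F4 | 2, F4 => F3
  | 2, F5 => F6 | 2, F6 => F5 | 2, F7 => F8 | 2, F8 => F7

theorem normal_across (i : Fin 3) (f : Face) (j : Fin 3) :
    normal (across i f) j = if j = i then -normal f j else normal f j := by
  revert i f j; decide

theorem normal_eq_iff (i : Fin 3) (f : Face) (j : Fin 3) :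
    normal f j = normal (across i f) j ↔ j ≠ i := by
  revert i f j; decide

theorem across_across (i : Fin 3) (f : Face) : across i (across i f) = f := by
  revert i f; decide

theorem adj_iff {f g : Face} : faceGraph.Adj f g ↔ ∃ i, g = across i f := by
  revert f g; decide

theorem adj_across (i : Fin 3) (f : Face) : faceGraph.Adj f (across i f) := adj_iff.2 ⟨i, rfl⟩

theorem prod_normal_across (i : Fin 3) (f : Face) :
    ∏ j, normal (across i f) j = -∏ j, normal f j := by
  revert i f; decide

/-- The faces on the path which starts at `u` and crosses the edges named by the word `w`. -/
def walk : Face → List (Fin 3) → List Face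
  | u, [] => [u]
  | u, i :: w => u :: walk (across i u) w

/-- The last face of `walk u w`. -/
def walkEnd : Face → List (Fin 3) → Face
  | u, [] => u
  | u, i :: w => walkEnd (across i u) w

theorem length_walk (u : Face) (w : List (Fin 3)) : (walk u w).length = w.length + 1 := by
  induction w generalizing u with
  | nil => rfl
  | cons i w ih => simp [walk, ih]

theorem head_walk (u : Face) (w : List (Fin 3)) : ∃ l, walk u w = u :: l := by
  cases w with
  | nil => exact ⟨_, rfl⟩
  | cons i w => exact ⟨_, rfl⟩

theorem head?_walk (u : Face) (w : List (Fin 3)) : (walk u w).head? = some u := by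
  obtain ⟨l, hl⟩ := head_walk u w
  simp [hl]

theorem mem_walk_self (u : Face) (w : List (Fin 3)) : u ∈ walk u w := by
  obtain ⟨l, hl⟩ := head_walk u w
  simp [hl]

theorem getLast?_walk (u : Face) (w : List (Fin 3)) : (walk u w).getLast? = some (walkEnd u w) := by
  induction w generalizing u with
  | nil => rfl
  | cons i w ih =>
    obtain ⟨l, hl⟩ := head_walk (across i u) w
    rw [walk, walkEnd, ← ih, hl, List.getLast?_cons_cons]

theorem walkEnd_mem_walk (u : Face) (w : List (Fin 3)) : walkEnd u w ∈ walk u w :=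
  List.mem_of_getLast? (getLast?_walk u w)

theorem isChain_walk (u : Face) (w : List (Fin 3)) : (walk u w).IsChain faceGraph.Adj := by
  induction w generalizing u with
  | nil => simp [walk]
  | cons i w ih =>
    obtain ⟨l, hl⟩ := head_walk (across i u) w
    have := ih (across i u)
    rw [walk]
    rw [hl] at this ⊢
    exact List.isChain_cons_cons.2 ⟨adj_across i u, this⟩

theorem exists_walk {u : Face} {l : List Face} (hl : (u :: l).IsChain faceGraph.Adj) :
    ∃ w, u :: l = walk u w := by
  induction l generalizing u with
  | nil => exact ⟨[], rfl⟩
  | cons v l ih =>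
    obtain ⟨h, hl⟩ := List.isChain_cons_cons.1 hl
    obtain ⟨i, rfl⟩ := adj_iff.1 h
    obtain ⟨w, hw⟩ := ih hl
    exact ⟨i :: w, by rw [walk, hw]⟩

theorem walk_append (u : Face) (w : List (Fin 3)) (i : Fin 3) :
    walk u (w ++ [i]) = walk u w ++ [across i (walkEnd u w)] := by
  induction w generalizing u with
  | nil => rfl
  | cons j w ih => simp [walk, walkEnd, ih]

theorem walkEnd_append (u : Face) (w w' : List (Fin 3)) :
    walkEnd u (w ++ w') = walkEnd (walkEnd u w) w' := by
  induction w generalizing u with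
  | nil => rfl
  | cons j w ih => simp [walkEnd, ih]

theorem walkEnd_reverse (u : Face) (w : List (Fin 3)) : walkEnd (walkEnd u w) w.reverse = u := by
  induction w generalizing u with
  | nil => rfl
  | cons j w ih => rw [walkEnd, List.reverse_cons, walkEnd_append, ih, walkEnd, walkEnd,
      across_across]

theorem walk_reverse (u : Face) (w : List (Fin 3)) :
    walk (walkEnd u w) w.reverse = (walk u w).reverse := by
  induction w generalizing u with
  | nil => rfl
  | cons j w ih =>
    rw [walkEnd, List.reverse_cons, walk_append, ih, walkEnd_reverse, across_across, walk,
      List.reverse_cons]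

theorem walk_prefix (u : Face) {w w' : List (Fin 3)} (h : w <+: w') : walk u w <+: walk u w' := by
  obtain ⟨x, rfl⟩ := h
  induction w generalizing u with
  | nil =>
    obtain ⟨l, hl⟩ := head_walk u x
    exact ⟨l, by simp [walk, hl]⟩
  | cons j w ih => simpa [walk] using ih (across j u)

theorem exists_prefix_of_mem_walk {u v : Face} {w : List (Fin 3)} (h : v ∈ walk u w) :
    ∃ w', w' <+: w ∧ walkEnd u w' = v := by
  induction w generalizing u with
  | nil => exact ⟨[], List.prefix_rfl, (List.mem_singleton.1 h).symm⟩
  | cons j w ih =>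
    rcases List.mem_cons.1 h with h | h
    · exact ⟨[], List.nil_prefix, h.symm⟩
    · obtain ⟨w', h1, h2⟩ := ih h
      exact ⟨j :: w', by simpa using h1, h2⟩

theorem mem_verts_pathGraph {l : List Face} {f : Face} : f ∈ (pathGraph l).verts ↔ f ∈ l := Iff.rfl

theorem pathGraph_mono {l l' : List Face} (h : l <:+: l') : pathGraph l ≤ pathGraph l' :=
  ⟨fun _ hf => h.subset hf, fun _ _ hf => ⟨hf.1, hf.2.imp (·.trans h) (·.trans h)⟩⟩

theorem pathGraph_reverse (l : List Face) : pathGraph l.reverse = pathGraph l := by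
  have h : ∀ a b, [a, b] <:+: l.reverse ↔ [b, a] <:+: l := fun a b => by
    rw [← List.reverse_infix]; simp
  ext a b
  · simp [pathGraph]
  · simp only [pathGraph, h]
    tauto

/-- Any two faces of a path are joined by a subpath. -/
theorem exists_subwalk {u : Face} {w : List (Fin 3)} (hw : (walk u w).Nodup) {k l : Face}
    (hk : k ∈ walk u w) (hl : l ∈ walk u w) :
    ∃ x, walkEnd k x = l ∧ (walk k x).Nodup ∧ pathGraph (walk k x) ≤ pathGraph (walk u w) := by
  have key : ∀ {l}, l ∈ walk u w →
      ∃ x, walkEnd u x = l ∧ (walk u x).Nodup ∧ pathGraph (walk u x) ≤ pathGraph (walk u w) := by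
    intro l hl
    obtain ⟨x, hx, rfl⟩ := exists_prefix_of_mem_walk hl
    have := walk_prefix u hx
    exact ⟨x, rfl, this.sublist.nodup hw, pathGraph_mono this.isInfix⟩
  induction w generalizing u with
  | nil =>
    obtain rfl : k = u := by simpa [walk] using hk
    exact key hl
  | cons j w ih =>
    have hle : pathGraph (walk (across j u) w) ≤ pathGraph (walk u (j :: w)) :=
      pathGraph_mono (List.suffix_cons _ _).isInfix
    rcases List.mem_cons.1 hk with rfl | hk'
    · exact key hl
    rcases List.mem_cons.1 hl with rfl | hl'
    · obtain ⟨x, rfl, hx, hx'⟩ := key hk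
      refine ⟨x.reverse, walkEnd_reverse _ _, ?_, ?_⟩
      · rw [walk_reverse]; exact List.nodup_reverse.2 hx
      · rwa [walk_reverse, pathGraph_reverse]
    have hn : (walk (across j u) w).Nodup := (List.nodup_cons.1 hw).2
    obtain ⟨x, h1, h2, h3⟩ := ih hn hk' hl' (fun {l} hl => by
      obtain ⟨x, hx, rfl⟩ := exists_prefix_of_mem_walk hl
      have := walk_prefix (across j u) hx
      exact ⟨x, rfl, this.sublist.nodup hn, pathGraph_mono this.isInfix⟩)
    exact ⟨x, h1, h2, h3.trans hle⟩

/-- The translation of the cube of sign vectors that maps `F1` to `u`. -/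
def translate (u f : Face) : Face :=
  (if normal f 0 = 1 then id else across 0) ((if normal f 1 = 1 then id else across 1)
    ((if normal f 2 = 1 then id else across 2) u))

theorem translate_across (u : Face) (i : Fin 3) (f : Face) :
    translate u (across i f) = across i (translate u f) := by
  revert u i f; decide

theorem translate_F1 (u : Face) : translate u F1 = u := by revert u; decide

theorem translate_injective (u : Face) : Function.Injective (translate u) := by
  revert u; unfold Function.Injective; decide

theorem walk_translate (u v : Face) (w : List (Fin 3)) :
    walk (translate u v) w = (walk v w).map (translate u) := by
  induction w generalizing v with
  | nil => rfl
  | cons i w ih => rw [walk, walk, ← translate_across, ih, List.map_cons]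

theorem walkEnd_translate (u v : Face) (w : List (Fin 3)) :
    walkEnd (translate u v) w = translate u (walkEnd v w) := by
  induction w generalizing v with
  | nil => rfl
  | cons i w ih => rw [walkEnd, walkEnd, ← translate_across, ih]

/-- Whether a path is simple depends only on its word. -/
theorem nodup_walk_iff (u : Face) (w : List (Fin 3)) : (walk u w).Nodup ↔ (walk F1 w).Nodup := by
  conv_lhs => rw [← translate_F1 u, walk_translate, List.nodup_map_iff (translate_injective u)]

theorem walkEnd_eq_iff (u : Face) (w w' : List (Fin 3)) :
    walkEnd u w = walkEnd u w' ↔ walkEnd F1 w = walkEnd F1 w' := by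
  conv_lhs => rw [← translate_F1 u, walkEnd_translate, walkEnd_translate,
    (translate_injective u).eq_iff]

/-- The words of length at most `n` of simple paths. -/
def simpleWords : ℕ → List (List (Fin 3))
  | 0 => [[]]
  | n + 1 => [] :: ([0, 1, 2].flatMap fun i => (simpleWords n).map (i :: ·)).filter
      fun w => (walk F1 w).Nodup

theorem mem_simpleWords_of_nodup {n : ℕ} {w : List (Fin 3)} (hw : (walk F1 w).Nodup)
    (hn : w.length ≤ n) : w ∈ simpleWords n := by
  induction w generalizing n with
  | nil => cases n <;> simp [simpleWords]
  | cons i w ih =>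
    cases n with
    | zero => simp at hn
    | succ n =>
      have : w ∈ simpleWords n := ih
        ((nodup_walk_iff _ _).1 (List.nodup_cons.1 hw).2) (by simpa using hn)
      simp only [simpleWords, List.mem_cons, List.mem_filter, List.mem_flatMap, List.mem_map]
      refine Or.inr ⟨⟨i, by fin_cases i <;> simp, w, this, rfl⟩, by simpa using hw⟩

theorem mem_simpleWords {u : Face} {w : List (Fin 3)} (hw : (walk u w).Nodup) :
    w ∈ simpleWords 7 := by
  refine mem_simpleWords_of_nodup ((nodup_walk_iff _ _).1 hw) ?_
  have h := hw.length_le_card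
  rw [length_walk] at h
  have : Fintype.card Face = 8 := rfl
  omega

/-! ### Rolling a triangle along a word -/

/-- Replacement of the `i`-th vertex of the triangle `t` by its mirror image in the opposite edge,
which for an equilateral triangle is the image under the half-turn about the midpoint. -/
def reflect {V : Type*} [AddCommGroup V] (i : Fin 3) (t : Fin 3 → V) : Fin 3 → V :=
  Function.update t i (t (i + 1) + t (i + 2) - t i)

/-- The triangle reached from `t` by rolling over the edges named by a word. -/
def unfold {V : Type*} [AddCommGroup V] : List (Fin 3) → (Fin 3 → V) → Fin 3 → V
  | [], t => t
  | i :: w, t => unfold w (reflect i t)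

/-- The vertices of a triangle in barycentric coordinates with respect to this triangle. -/
def unitFrame (i k : Fin 3) : ℤ := if i = k then 1 else 0

/-- Twice the squared distance between the `i`-th vertex of an equilateral triangle with edges of
length `1` and the `j`-th vertex of the triangle reached from it by the word `w`. -/
def sqTable (w : List (Fin 3)) (i j : Fin 3) : ℤ :=
  (unitFrame i 0 - unfold w unitFrame j 0) ^ 2 + (unitFrame i 1 - unfold w unitFrame j 1) ^ 2 +
    (unitFrame i 2 - unfold w unitFrame j 2) ^ 2

/-- The words without repeated letters. -/
def shortWords : List (List (Fin 3)) := (simpleWords 3).filter fun w => w.Nodup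

/-- A vertex-by-vertex comparison of the path `w` with two paths `x` and `y` between the same
faces. -/
def Dominated (w x y : List (Fin 3)) : Prop :=
  walkEnd F1 x = walkEnd F1 w ∧ walkEnd F1 y = walkEnd F1 w ∧
    (∀ i j, sqTable x i j + sqTable y i j ≤ 2 * sqTable w i j) ∧
    ∀ a ∈ w.head?, ∀ b ∈ w.getLast?, sqTable x a b + sqTable y a b < 2 * sqTable w a b

instance (w x y : List (Fin 3)) : Decidable (Dominated w x y) :=
  inferInstanceAs (Decidable (_ ∧ _ ∧ _ ∧ _))

/-- The finite verification behind `exists_dominated`: a single shorter path suffices, except for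
the words `a b a c a`. -/
theorem exists_dominated_aux : ∀ w ∈ simpleWords 7, ¬ w.Nodup →
    (∃ x ∈ shortWords, Dominated w x x) ∨
      ∃ a b c, w = [a, b, a, c, a] ∧ [b, a, c] ∈ shortWords ∧ [b, c, a] ∈ shortWords ∧
        Dominated w [b, a, c] [b, c, a] := by
  decide +kernel

theorem length_le_of_nodup {w : List (Fin 3)} (h : w.Nodup) : w.length ≤ 3 := by
  simpa using h.length_le_card

theorem nodup_walk_of_nodup (u : Face) {w : List (Fin 3)} (h : w.Nodup) : (walk u w).Nodup := by
  rw [nodup_walk_iff]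
  have h3 := length_le_of_nodup h
  rcases w with _ | ⟨a, _ | ⟨b, _ | ⟨c, _ | ⟨d, w⟩⟩⟩⟩
  · decide
  · revert a; decide
  · revert a b; decide
  · revert a b c; decide
  · simp at h3; omega

theorem mem_shortWords {w : List (Fin 3)} : w ∈ shortWords ↔ w.Nodup := by
  simp only [shortWords, List.mem_filter, decide_eq_true_eq, and_iff_right_iff_imp]
  exact fun h => mem_simpleWords_of_nodup (nodup_walk_of_nodup _ h) (length_le_of_nodup h)

/-- Every simple path that repeats a letter is at least as long, vertex by vertex, as the average of
two paths without repeated letters, and the comparison is strict at the pair of vertices that are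
opposite to the first and to the last edge crossed. -/
theorem exists_dominated {u : Face} {w : List (Fin 3)} (hw : (walk u w).Nodup) (hn : ¬ w.Nodup) :
    ∃ x y, x.Nodup ∧ y.Nodup ∧ walkEnd u x = walkEnd u w ∧ walkEnd u y = walkEnd u w ∧
      (∀ i j, sqTable x i j + sqTable y i j ≤ 2 * sqTable w i j) ∧
      ∀ a ∈ w.head?, ∀ b ∈ w.getLast?, sqTable x a b + sqTable y a b < 2 * sqTable w a b := by
  rcases exists_dominated_aux w (mem_simpleWords hw) hn with
    ⟨x, hx, h⟩ | ⟨a, b, c, -, hx, hy, h⟩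
  · exact ⟨x, x, mem_shortWords.1 hx, mem_shortWords.1 hx, (walkEnd_eq_iff u _ _).2 h.1,
      (walkEnd_eq_iff u _ _).2 h.1, h.2.2⟩
  · exact ⟨_, _, mem_shortWords.1 hx, mem_shortWords.1 hy, (walkEnd_eq_iff u _ _).2 h.1,
      (walkEnd_eq_iff u _ _).2 h.2.1, h.2.2⟩

/-- A path without repeated letters and a simple path with repeated letters do not have the same
faces: of two paths with four faces, only the one without repeated letters contains opposite
faces. -/
theorem pathGraph_ne {u v : Face} {w x : List (Fin 3)} (hw : w.Nodup) (hx : (walk v x).Nodup)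
    (hn : ¬ x.Nodup) : pathGraph (walk u w) ≠ pathGraph (walk v x) := by
  intro h
  have hm : ∀ f, f ∈ walk u w ↔ f ∈ walk v x := fun f => by
    rw [← mem_verts_pathGraph, h, mem_verts_pathGraph]
  have hl : w.length = x.length := by
    have := ((List.perm_ext_iff_of_nodup (nodup_walk_of_nodup u hw) hx).2 hm).length_eq
    simpa [length_walk] using this
  have h3 := length_le_of_nodup hw
  rw [hl] at h3
  rcases x with _ | ⟨a, _ | ⟨b, _ | ⟨c, _ | ⟨d, x⟩⟩⟩⟩
  · simp at hn
  · simp at hn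
  · have h1 : ∀ (v : Face) (a b : Fin 3), (walk v [a, b]).Nodup → [a, b].Nodup := by decide
    exact hn (h1 v a b hx)
  · rcases w with _ | ⟨a', _ | ⟨b', _ | ⟨c', _ | ⟨d', w⟩⟩⟩⟩ <;> simp at hl
    have h1 : ∀ (v : Face) (a b c : Fin 3), (walk v [a, b, c]).Nodup → ¬ [a, b, c].Nodup →
        ∀ f ∈ walk v [a, b, c], across 0 (across 1 (across 2 f)) ∉ walk v [a, b, c] := by
      decide +kernel
    have h2 : ∀ (v : Face) (a b c : Fin 3), [a, b, c].Nodup →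
        across 0 (across 1 (across 2 v)) ∈ walk v [a, b, c] := by
      decide +kernel
    exact h1 v a b c hx hn u ((hm u).1 (mem_walk_self _ _)) ((hm _).1 (h2 u a' b' c' hw))
  · simp at h3; omega

/-- Renaming the letters of a word renames the vertices. -/
theorem sqTable_map (σ : Equiv.Perm (Fin 3)) {w : List (Fin 3)} (hw : w.Nodup) (i j : Fin 3) :
    sqTable (w.map σ) (σ i) (σ j) = sqTable w i j := by
  have : ∀ σ : Equiv.Perm (Fin 3), ∀ w ∈ shortWords, ∀ i j,
      sqTable (w.map σ) (σ i) (σ j) = sqTable w i j := by decide +kernel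
  exact this σ w (mem_shortWords.2 hw) i j

theorem walkEnd_map_eq_iff (σ : Equiv.Perm (Fin 3)) {w x : List (Fin 3)} (hw : w.Nodup)
    (hx : x.Nodup) (u : Face) :
    walkEnd u (w.map σ) = walkEnd u (x.map σ) ↔ walkEnd F1 w = walkEnd F1 x := by
  rw [walkEnd_eq_iff]
  have : ∀ σ : Equiv.Perm (Fin 3), ∀ w ∈ shortWords, ∀ x ∈ shortWords,
      walkEnd F1 (w.map σ) = walkEnd F1 (x.map σ) ↔ walkEnd F1 w = walkEnd F1 x := by
    decide +kernel
  exact this σ w (mem_shortWords.2 hw) x (mem_shortWords.2 hx)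

/-! ### Distances in the plane unfolding -/

theorem reflect_comp {V W : Type*} [AddCommGroup V] [AddCommGroup W] (φ : V →+ W) (i : Fin 3)
    (t : Fin 3 → V) : reflect i (φ ∘ t) = φ ∘ reflect i t := by
  funext j
  by_cases h : j = i
  · subst h; simp [reflect]
  · simp [reflect, h]

theorem unfold_comp {V W : Type*} [AddCommGroup V] [AddCommGroup W] (φ : V →+ W)
    (w : List (Fin 3)) (t : Fin 3 → V) : unfold w (φ ∘ t) = φ ∘ unfold w t := by
  induction w generalizing t with
  | nil => rfl
  | cons i w ih => rw [unfold, unfold, reflect_comp, ih]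

/-- The integral combination of the vertices of `t` with given coefficients. -/
noncomputable def combination (t : Fin 3 → Plane) : (Fin 3 → ℤ) →+ Plane where
  toFun z := ∑ m, (z m : ℝ) • t m
  map_zero' := by simp
  map_add' x y := by simp [add_smul, Finset.sum_add_distrib]

theorem combination_unitFrame (t : Fin 3 → Plane) : combination t ∘ unitFrame = t := by
  funext i
  simp [combination, unitFrame]

theorem unfold_eq_combination (w : List (Fin 3)) (t : Fin 3 → Plane) (j : Fin 3) :
    unfold w t j = ∑ m, (unfold w unitFrame j m : ℝ) • t m := by
  conv_lhs => rw [← combination_unitFrame t, unfold_comp]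
  rfl

theorem reflect_of_eq {V : Type*} [AddCommGroup V] {i : Fin 3} {t : Fin 3 → V} {j : Fin 3}
    (h : j ≠ i) : reflect i t j = t j := by
  simp [reflect, h]

/-- The coordinates of the rolled triangle add up to `1`, and all its edges have squared length `2`
in coordinate space. -/
theorem unfold_unitFrame (w : List (Fin 3)) :
    (∀ j, ∑ m, unfold w unitFrame j m = 1) ∧
      ∀ j l, j ≠ l → ∑ m, (unfold w unitFrame j m - unfold w unitFrame l m) ^ 2 = 2 := by
  have key : ∀ s : Fin 3 → Fin 3 → ℤ, ((∀ j, ∑ m, s j m = 1) ∧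
      ∀ j l, j ≠ l → ∑ m, (s j m - s l m) ^ 2 = 2) → ((∀ j, ∑ m, unfold w s j m = 1) ∧
      ∀ j l, j ≠ l → ∑ m, (unfold w s j m - unfold w s l m) ^ 2 = 2) := by
    induction w with
    | nil => exact fun s h => h
    | cons i w ih =>
      refine fun s h => ih _ ⟨fun j => ?_, fun j l hjl => ?_⟩
      · have h0 := h.1 0
        have h1 := h.1 1
        have h2 := h.1 2
        simp only [Fin.sum_univ_three] at h0 h1 h2 ⊢
        fin_cases i <;> fin_cases j <;> simp [reflect] <;> linarith
      · have h01 := h.2 0 1 (by decide)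
        have h02 := h.2 0 2 (by decide)
        have h12 := h.2 1 2 (by decide)
        simp only [Fin.sum_univ_three] at h01 h02 h12 ⊢
        fin_cases i <;> fin_cases j <;> fin_cases l <;> simp [reflect] at hjl ⊢ <;> linarith
  exact key _ (by decide)

theorem dist_eq_one_iff (x y : Plane) :
    dist x y = 1 ↔ (x 0 - y 0) ^ 2 + (x 1 - y 1) ^ 2 = 1 := by
  rw [EuclideanSpace.dist_eq, Real.sqrt_eq_one, Fin.sum_univ_two]
  simp [Real.dist_eq, sq_abs]

/-- The variance of the vertices of an equilateral triangle with edges of length `1` when they carry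
the weights `c i`. -/
noncomputable def spread (c : Fin 3 → ℝ) : ℝ := c 0 * c 1 + c 0 * c 2 + c 1 * c 2

/-- The average over the pairs of vertices, with the barycentric coordinates of two points as
weights, of the squared distances after unfolding along `w`. -/
noncomputable def meanSq (w : List (Fin 3)) (c d : Fin 3 → ℝ) : ℝ :=
  (∑ i, ∑ j, c i * d j * sqTable w i j) / 2

/-- The squared distance of two points unfolded along `w` differs from `meanSq` by a quantity which
does not depend on `w`. -/
theorem dist_sq_unfold {t : Fin 3 → Plane} (ht : ∀ i j, i ≠ j → dist (t i) (t j) = 1)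
    (w : List (Fin 3)) {c d : Fin 3 → ℝ} (hc : ∑ i, c i = 1) (hd : ∑ i, d i = 1) :
    dist (∑ i, c i • t i) (∑ j, d j • unfold w t j) ^ 2 = meanSq w c d - spread c - spread d := by
  obtain ⟨hs, hq⟩ := unfold_unitFrame w
  obtain ⟨U, hU⟩ : ∃ U : Fin 3 → Fin 3 → ℝ, ∀ j m, U j m = unfold w unitFrame j m :=
    ⟨_, fun _ _ => rfl⟩
  have hs' : ∀ j, U j 0 + U j 1 + U j 2 = 1 := fun j => by
    have := hs j
    rw [Fin.sum_univ_three] at this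
    rw [hU, hU, hU]; exact_mod_cast this
  have hq' : ∀ j l, j ≠ l → (U j 0 - U l 0) ^ 2 + (U j 1 - U l 1) ^ 2 + (U j 2 - U l 2) ^ 2 = 2 :=
    fun j l hjl => by
      have := hq j l hjl
      rw [Fin.sum_univ_three] at this
      simp only [hU]; exact_mod_cast this
  have hN : ∀ i j, (sqTable w i j : ℝ) = ((unitFrame i 0 : ℝ) - U j 0) ^ 2 +
      ((unitFrame i 1 : ℝ) - U j 1) ^ 2 + ((unitFrame i 2 : ℝ) - U j 2) ^ 2 := fun i j => by
    simp only [hU, sqTable]; push_cast; rfl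
  obtain ⟨e, he⟩ : ∃ e : Fin 3 → ℝ, ∀ m, e m = c m - (d 0 * U 0 m + d 1 * U 1 m + d 2 * U 2 m) :=
    ⟨_, fun _ => rfl⟩
  rw [Fin.sum_univ_three] at hc hd
  have e0 : e 0 = -e 1 - e 2 := by
    rw [he, he, he]
    linear_combination hc - d 0 * hs' 0 - d 1 * hs' 1 - d 2 * hs' 2 - hd
  have key : ∀ x, (∑ i, c i • t i) x - (∑ j, d j • unfold w t j) x =
      e 0 * t 0 x + e 1 * t 1 x + e 2 * t 2 x := fun x => by
    simp only [unfold_eq_combination w t, Fin.sum_univ_three, PiLp.add_apply, PiLp.smul_apply,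
      smul_eq_mul, ← hU, he]
    ring
  have t01 := (dist_eq_one_iff _ _).1 (ht 0 1 (by decide))
  have t02 := (dist_eq_one_iff _ _).1 (ht 0 2 (by decide))
  have t12 := (dist_eq_one_iff _ _).1 (ht 1 2 (by decide))
  -- the difference of the points has coordinates with sum `0` in an equilateral frame
  have step : dist (∑ i, c i • t i) (∑ j, d j • unfold w t j) ^ 2 =
      (e 0 ^ 2 + e 1 ^ 2 + e 2 ^ 2) / 2 := by
    rw [EuclideanSpace.dist_eq, Real.sq_sqrt (by positivity), Fin.sum_univ_two]
    simp only [Real.dist_eq, sq_abs, key, e0]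
    -- `(e 1 + e 2) ^ 2 + e 1 ^ 2 + e 2 ^ 2 = 2 * (e 1 ^ 2 + e 1 * e 2 + e 2 ^ 2)`
    linear_combination (e 1 ^ 2 + e 1 * e 2) * t01 + (e 2 ^ 2 + e 1 * e 2) * t02 - e 1 * e 2 * t12
  have c0 : c 0 = 1 - c 1 - c 2 := by linarith
  have d0 : d 0 = 1 - d 1 - d 2 := by linarith
  have q01 := hq' 0 1 (by decide)
  have q02 := hq' 0 2 (by decide)
  have q12 := hq' 1 2 (by decide)
  rw [step]
  simp only [meanSq, spread, Fin.sum_univ_three, hN, he, unitFrame]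
  simp only [c0, d0]
  simp
  linear_combination (-(1 - d 1 - d 2) * d 1 / 2) * q01 + (-(1 - d 1 - d 2) * d 2 / 2) * q02 -
    (d 1 * d 2 / 2) * q12

theorem signedArea_reflect (i : Fin 3) (t : Fin 3 → Plane) :
    signedArea (reflect i t) = -signedArea t := by
  fin_cases i <;> simp [signedArea, reflect] <;> ring

theorem IsPlacement.reflect {f : Face} {t : Fin 3 → Plane} (h : IsPlacement f t) (i : Fin 3) :
    IsPlacement (across i f) (reflect i t) where
  unit := by
    have h01 := h.unit 0 1 (by decide)
    have h02 := h.unit 0 2 (by decide)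
    have h12 := h.unit 1 2 (by decide)
    rw [dist_eq_one_iff] at h01 h02 h12
    intro j l hjl
    rw [dist_eq_one_iff]
    fin_cases i <;> fin_cases j <;> fin_cases l <;> simp [Octahedron.reflect] at hjl ⊢ <;> linarith
  exterior_up := by
    rw [signedArea_reflect, prod_normal_across]
    push_cast
    simpa using h.exterior_up

/-- Two equilateral triangles on opposite sides of a common edge are mirror images. -/
theorem third_vertex {a b x y : Plane} (hab : dist a b = 1) (hax : dist a x = 1)
    (hbx : dist b x = 1) (hay : dist a y = 1) (hby : dist b y = 1)
    (h : ((b 0 - a 0) * (x 1 - a 1) - (b 1 - a 1) * (x 0 - a 0)) *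
      ((b 0 - a 0) * (y 1 - a 1) - (b 1 - a 1) * (y 0 - a 0)) < 0) : y = a + b - x := by
  rw [dist_eq_one_iff] at *
  -- both triangles have twice the signed area `± √3 / 2`, and the signs are different
  obtain ⟨p, hp⟩ : ∃ p, p = (b 0 - a 0) * (x 1 - a 1) - (b 1 - a 1) * (x 0 - a 0) := ⟨_, rfl⟩
  obtain ⟨q, hq⟩ : ∃ q, q = (b 0 - a 0) * (y 1 - a 1) - (b 1 - a 1) * (y 0 - a 0) := ⟨_, rfl⟩
  rw [← hp, ← hq] at h
  have hp2 : p ^ 2 = 3 / 4 := by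
    have h1 : (b 0 - a 0) * (x 0 - a 0) + (b 1 - a 1) * (x 1 - a 1) = 1 / 2 := by
      linear_combination (hab + hax - hbx) / 2
    have : p ^ 2 + ((b 0 - a 0) * (x 0 - a 0) + (b 1 - a 1) * (x 1 - a 1)) ^ 2 = 1 := by
      rw [hp]
      linear_combination ((a 0 - x 0) ^ 2 + (a 1 - x 1) ^ 2) * hab + hax
    rw [h1] at this
    linarith
  have hq2 : q ^ 2 = 3 / 4 := by
    have h1 : (b 0 - a 0) * (y 0 - a 0) + (b 1 - a 1) * (y 1 - a 1) = 1 / 2 := by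
      linear_combination (hab + hay - hby) / 2
    have : q ^ 2 + ((b 0 - a 0) * (y 0 - a 0) + (b 1 - a 1) * (y 1 - a 1)) ^ 2 = 1 := by
      rw [hq]
      linear_combination ((a 0 - y 0) ^ 2 + (a 1 - y 1) ^ 2) * hab + hay
    rw [h1] at this
    linarith
  have hpq : p + q = 0 := by
    have h1 : (p + q) * (p - q) = 0 := by linear_combination hp2 - hq2
    rcases mul_eq_zero.1 h1 with h1 | h1
    · exact h1
    · nlinarith [sq_nonneg p]
  -- `x + y - a - b` is orthogonal and parallel to the edge `b - a`
  have hx : (b 0 - a 0) * (x 0 + y 0 - a 0 - b 0) + (b 1 - a 1) * (x 1 + y 1 - a 1 - b 1) = 0 := by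
    linear_combination (hax - hbx) / 2 + (hay - hby) / 2
  have hy : (b 0 - a 0) * (x 1 + y 1 - a 1 - b 1) - (b 1 - a 1) * (x 0 + y 0 - a 0 - b 0) = 0 := by
    rw [hp, hq] at hpq
    linear_combination hpq
  ext m
  fin_cases m
  · simp
    linear_combination (b 0 - a 0) * hx - (b 1 - a 1) * hy - (x 0 + y 0 - a 0 - b 0) * hab
  · simp
    linear_combination (b 1 - a 1) * hx + (b 0 - a 0) * hy - (x 1 + y 1 - a 1 - b 1) * hab

/-- A placement of a face determines the placement of a neighbour that is glued to it. -/
theorem eq_reflect {f : Face} {i : Fin 3} {t s : Fin 3 → Plane} (ht : IsPlacement f t)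
    (hs : IsPlacement (across i f) s) (h : ∀ j, j ≠ i → t j = s j) : s = reflect i t := by
  have h1 := ht.exterior_up
  have h2 := hs.exterior_up
  rw [prod_normal_across] at h2
  have h3 : signedArea t * signedArea s < 0 := by
    push_cast at h1 h2
    by_contra! h4
    nlinarith [mul_pos h1 h2, sq_nonneg (∏ j, (normal f j : ℝ)),
      mul_nonneg (sq_nonneg (∏ j, (normal f j : ℝ))) h4]
  funext j
  by_cases hj : j = i
  · subst hj
    have n1 : j + 1 ≠ j := (by decide : ∀ j : Fin 3, j + 1 ≠ j) j
    have n2 : j + 2 ≠ j := (by decide : ∀ j : Fin 3, j + 2 ≠ j) j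
    have n3 : j + 1 ≠ j + 2 := (by decide : ∀ j : Fin 3, j + 1 ≠ j + 2) j
    have e1 := h (j + 1) n1
    have e2 := h (j + 2) n2
    simp only [reflect, Function.update_self]
    refine third_vertex (ht.unit _ _ n3) (ht.unit _ _ n1) (ht.unit _ _ n2)
      (by rw [e1]; exact hs.unit _ _ n1) (by rw [e2]; exact hs.unit _ _ n2) ?_
    have area : ∀ r : Fin 3 → Plane, signedArea r = (r (j + 2) 0 - r (j + 1) 0) *
        (r j 1 - r (j + 1) 1) - (r (j + 2) 1 - r (j + 1) 1) * (r j 0 - r (j + 1) 0) := by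
      intro r
      fin_cases j <;> simp [signedArea] <;> ring
    rw [area t, area s, ← e1, ← e2] at h3
    exact h3
  · rw [reflect_of_eq hj, h j hj]

/-! ### Points of the octahedron and orientations of paths -/

/-- The barycentric coordinates of a point with respect to the vertices of the face `f`. -/
noncomputable def bary (f : Face) (p : Space) (i : Fin 3) : ℝ := √2 * (normal f i : ℝ) * p i

theorem place_eq (f : Face) (t : Fin 3 → Plane) (p : Space) :
    place f t p = ∑ i, bary f p i • t i := rfl

theorem bary_sum_vertex (f : Face) (c : Fin 3 → ℝ) : bary f (∑ i, c i • vertex f i) = c := by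
  have h2 := Real.mul_self_sqrt (show (0:ℝ) ≤ 2 by norm_num)
  funext j
  have h := normal_mul_self f j
  simp only [bary, Fin.sum_univ_three, PiLp.add_apply, PiLp.smul_apply, smul_eq_mul, vertex,
    PiLp.single_apply]
  fin_cases j <;> simp at h ⊢ <;> field_simp <;> linear_combination (c _) * h

theorem sum_bary_smul_vertex (f : Face) (p : Space) : ∑ i, bary f p i • vertex f i = p := by
  ext j
  have h := normal_mul_self f j
  simp only [bary, Fin.sum_univ_three, PiLp.add_apply, PiLp.smul_apply, smul_eq_mul, vertex,
    PiLp.single_apply]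
  fin_cases j <;> simp at h ⊢ <;> field_simp <;> linear_combination (p _) * h

theorem mem_region_iff {f : Face} {p : Space} :
    p ∈ region f ↔ (∀ i, 0 ≤ bary f p i) ∧ ∑ i, bary f p i = 1 := by
  constructor
  · refine fun hp => ⟨fun i => ?_, region_sum hp⟩
    have hc : Convex ℝ {p : Space | 0 ≤ bary f p i} := by
      intro a ha b hb x y hx hy hxy
      simp only [Set.mem_ofPred_eq, bary, PiLp.add_apply, PiLp.smul_apply, smul_eq_mul] at *
      nlinarith [mul_nonneg hx ha, mul_nonneg hy hb]
    refine convexHull_min ?_ hc hp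
    rintro _ ⟨j, rfl⟩
    have := bary_sum_vertex f (Pi.single j 1)
    have h2 : ∑ i, (Pi.single j 1 : Fin 3 → ℝ) i • vertex f i = vertex f j := by
      simp [Pi.single_apply]
    rw [h2] at this
    simp only [Set.mem_ofPred_eq, this, Pi.single_apply]
    split_ifs <;> norm_num
  · rintro ⟨h0, h1⟩
    rw [← sum_bary_smul_vertex f p]
    exact (convex_convexHull ℝ _).sum_mem (fun i _ => h0 i) h1
      fun i _ => subset_convexHull ℝ _ ⟨i, rfl⟩

theorem sum_smul_mem_image (f : Face) (t : Fin 3 → Plane) {c : Fin 3 → ℝ} (h0 : ∀ i, 0 ≤ c i)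
    (h1 : ∑ i, c i = 1) : ∑ i, c i • t i ∈ place f t '' region f := by
  refine ⟨∑ i, c i • vertex f i, mem_region_iff.2 ?_, ?_⟩
  · rw [bary_sum_vertex]; exact ⟨h0, h1⟩
  · rw [place_eq, bary_sum_vertex]

theorem bary_across (i : Fin 3) (f : Face) (p : Space) (j : Fin 3) :
    bary (across i f) p j = if j = i then -bary f p j else bary f p j := by
  rw [bary, normal_across]
  split_ifs <;> simp [bary]

theorem bary_across_of_eq_zero {i : Fin 3} {f : Face} {p : Space} (h : bary f p i = 0) :
    bary (across i f) p = bary f p := by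
  funext j
  rw [bary_across]
  split_ifs with hj
  · rw [hj, h, neg_zero]
  · rfl

/-- A zero barycentric coordinate puts the point on the edge shared with the neighbour. -/
theorem mem_region_across {i : Fin 3} {f : Face} {p : Space} (hp : p ∈ region f)
    (h : bary f p i = 0) : p ∈ region (across i f) := by
  rw [mem_region_iff] at hp ⊢
  rwa [bary_across_of_eq_zero h]

/-- A point with positive barycentric coordinates lies in one face only. -/
theorem eq_of_mem_region {f g : Face} {p : Space} (h : ∀ i, 0 < bary f p i) (hg : p ∈ region g) :
    g = f := by
  have h2 : (0:ℝ) < √2 := by positivity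
  have key : ∀ f g : Face, (∀ i, normal f i = normal g i) → g = f := by decide
  refine key f g fun i => ?_
  have h1 := h i
  have h3 := (mem_region_iff.1 hg).1 i
  have hf : ∀ (f : Face) i, normal f i = 1 ∨ normal f i = -1 := by decide
  rw [bary] at h1 h3
  rcases hf f i with a | a <;> rcases hf g i with b | b <;> rw [a] at h1 <;> rw [b] at h3 <;>
    rw [a, b] <;> push_cast at h1 h3 <;> linarith

/-- A point on a glued edge has the same image under the placements of both faces. -/
theorem place_across {i : Fin 3} {f : Face} {t s : Fin 3 → Plane}
    (h : ∀ j, normal f j = normal (across i f) j → t j = s j) {p : Space} (hp : bary f p i = 0) :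
    place (across i f) s p = place f t p := by
  rw [place_eq, place_eq, bary_across_of_eq_zero hp]
  refine Finset.sum_congr rfl fun j _ => ?_
  by_cases hj : j = i
  · rw [hj, hp, zero_smul, zero_smul]
  · rw [h j ((normal_eq_iff i f j).2 hj)]

theorem pathGraph_adj_cons (u : Face) (i : Fin 3) (w : List (Fin 3)) :
    (pathGraph (walk u (i :: w))).Adj u (across i u) := by
  obtain ⟨l, hl⟩ := head_walk (across i u) w
  exact ⟨adj_across i u, Or.inl ⟨[], l, by simp [walk, hl]⟩⟩

theorem pathGraph_tail_le (u : Face) (i : Fin 3) (w : List (Fin 3)) :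
    pathGraph (walk (across i u) w) ≤ pathGraph (walk u (i :: w)) :=
  pathGraph_mono (List.suffix_cons _ _).isInfix

theorem pathGraph_init_le (u : Face) (w : List (Fin 3)) (i : Fin 3) :
    pathGraph (walk u w) ≤ pathGraph (walk u (w ++ [i])) :=
  pathGraph_mono (walk_prefix u (List.prefix_append _ _)).isInfix

theorem pathGraph_adj_last (u : Face) (w : List (Fin 3)) (i : Fin 3) :
    (pathGraph (walk u (w ++ [i]))).Adj (walkEnd u w) (across i (walkEnd u w)) := by
  induction w generalizing u with
  | nil => exact pathGraph_adj_cons u i []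
  | cons j w ih => exact (pathGraph_tail_le u j (w ++ [i])).2 (ih (across j u))

/-- In every orientation, the end of a path is placed by rolling the first face along the path. -/
theorem IsOrientation.eq_unfold {H : DualGraph} {f g : Face} {t : Face → Fin 3 → Plane}
    (ht : IsOrientation H f g t) {u : Face} {w : List (Fin 3)} (h : pathGraph (walk u w) ≤ H) :
    t (walkEnd u w) = unfold w (t u) := by
  induction w generalizing u with
  | nil => rfl
  | cons i w ih =>
    have ha := h.2 (pathGraph_adj_cons u i w)
    have hr : t (across i u) = reflect i (t u) :=
      eq_reflect (ht.placement u ha.fst_mem) (ht.placement _ ha.snd_mem)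
        fun j hj => ht.glue _ _ ha j ((normal_eq_iff i u j).2 hj)
    rw [walkEnd, unfold, ← hr]
    exact ih ((pathGraph_tail_le u i w).trans h)

/-- The distance of `p`, in the face `u`, and `q`, in the last face of `walk u w`, in the plane
unfolding of this path. -/
noncomputable def chord (u : Face) (w : List (Fin 3)) (p q : Space) : ℝ :=
  √(meanSq w (bary u p) (bary (walkEnd u w) q) - spread (bary u p) -
    spread (bary (walkEnd u w) q))

/-- The distance of the images of two points is the same in all orientations, and depends only on
the path between their faces. -/
theorem IsOrientation.edist_eq {H : DualGraph} {f g : Face} {t : Face → Fin 3 → Plane}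
    (ht : IsOrientation H f g t) {u : Face} {w : List (Fin 3)} (h : pathGraph (walk u w) ≤ H)
    {p q : Space} (hp : p ∈ region u) (hq : q ∈ region (walkEnd u w)) :
    edist (place u (t u) p) (place (walkEnd u w) (t (walkEnd u w)) q) =
      ENNReal.ofReal (chord u w p q) := by
  rw [edist_dist, chord, ht.eq_unfold h, place_eq, place_eq, ← dist_sq_unfold
    (ht.placement u (h.1 (mem_walk_self u w))).unit w (mem_region_iff.1 hp).2
    (mem_region_iff.1 hq).2, Real.sqrt_sq dist_nonneg]

theorem infix_cons_walk {k l u v : Face} {w : List (Fin 3)}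
    (h : [k, l] <:+: u :: walk v w) : (k = u ∧ l = v) ∨ [k, l] <:+: walk v w := by
  rcases List.infix_cons_iff.1 h with h | h
  · left
    obtain ⟨x, hx⟩ := head_walk v w
    rw [hx] at h
    simpa using h
  · exact Or.inr h

theorem pathGraph_adj_cases {u k l : Face} {i : Fin 3} {w : List (Fin 3)}
    (h : (pathGraph (walk u (i :: w))).Adj k l) :
    (k = u ∧ l = across i u) ∨ (l = u ∧ k = across i u) ∨
      (pathGraph (walk (across i u) w)).Adj k l := by
  obtain ⟨ha, h | h⟩ := h
  · rcases infix_cons_walk h with h | h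
    · exact Or.inl h
    · exact Or.inr (Or.inr ⟨ha, Or.inl h⟩)
  · rcases infix_cons_walk h with h | h
    · exact Or.inr (Or.inl h)
    · exact Or.inr (Or.inr ⟨ha, Or.inr h⟩)

/-- A placement of the first face extends to an unfolding of a simple path. -/
theorem exists_unfolding {u : Face} {w : List (Fin 3)} (hw : (walk u w).Nodup)
    {s : Fin 3 → Plane} (hs : IsPlacement u s) :
    ∃ t : Face → Fin 3 → Plane, t u = s ∧ (∀ k ∈ walk u w, IsPlacement k (t k)) ∧
      ∀ k l, (pathGraph (walk u w)).Adj k l → ∀ i, normal k i = normal l i → t k i = t l i := by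
  induction w generalizing u s with
  | nil =>
    refine ⟨fun _ => s, rfl, fun k hk => ?_, fun _ _ _ _ _ => rfl⟩
    obtain rfl : k = u := List.mem_singleton.1 hk
    exact hs
  | cons i w ih =>
    obtain ⟨hu, hw⟩ := List.nodup_cons.1 hw
    obtain ⟨t, h1, h2, h3⟩ := ih hw (hs.reflect i)
    have hne : ∀ k ∈ walk (across i u) w, k ≠ u := fun k hk h => hu (h ▸ hk)
    have hs' : ∀ j, normal u j = normal (across i u) j → s j = t (across i u) j := fun j hj => by
      rw [h1, reflect_of_eq ((normal_eq_iff i u j).1 hj)]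
    have hu' := hne _ (mem_walk_self (across i u) w)
    refine ⟨Function.update t u s, by simp, fun k hk => ?_, fun k l hkl j hj => ?_⟩
    · rcases List.mem_cons.1 hk with rfl | hk
      · simpa using hs
      · rw [Function.update_of_ne (hne k hk)]; exact h2 k hk
    · rcases pathGraph_adj_cases hkl with ⟨rfl, rfl⟩ | ⟨rfl, rfl⟩ | h
      · rw [Function.update_self, Function.update_of_ne hu']; exact hs' j hj
      · rw [Function.update_self, Function.update_of_ne hu']; exact (hs' j hj.symm).symm
      · rw [Function.update_of_ne (hne k h.fst_mem), Function.update_of_ne (hne l h.snd_mem)]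
        exact h3 k l h j hj

/-- The equilateral triangle with edges of length `1` whose edge opposite to the vertex `a` is the
segment from `(0,0)` to `(1,0)`, the origin being the image of the vertex `l`. It is counterclockwise
if and only if `l = a + 1` in `Fin 3`. -/
noncomputable def baseTriangle (a l : Fin 3) (i : Fin 3) : Plane :=
  if i = a then !₂[1 / 2, √3 / 2] else if i = l then !₂[0, 0] else !₂[1, 0]

theorem isPlacement_baseTriangle {f : Face} {a l : Fin 3} (h : l ≠ a)
    (hl : l = a + 1 ↔ ∏ i, normal f i = 1) : IsPlacement f (baseTriangle a l) := by
  have h3 := Real.mul_self_sqrt (show (0:ℝ) ≤ 3 by norm_num)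
  have h3' : 0 < √3 := by positivity
  refine ⟨fun i j hij => ?_, ?_⟩
  · rw [dist_eq_one_iff]
    fin_cases a <;> fin_cases l <;> simp at h <;> fin_cases i <;> fin_cases j <;>
      simp [baseTriangle] at hij ⊢ <;> nlinarith
  · have hn : ∏ i, normal f i = 1 ∨ ∏ i, normal f i = -1 :=
      (by decide : ∀ f : Face, ∏ i, normal f i = 1 ∨ ∏ i, normal f i = -1) f
    rcases hn with hn | hn <;> rw [hn] at hl ⊢ <;> fin_cases a <;> fin_cases l <;>
      simp [signedArea, baseTriangle] at h hl ⊢ <;> linarith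

theorem isBased_baseTriangle (f : Face) (a l : Fin 3) :
    IsBased f (across a f) (baseTriangle a l) := by
  have h3' : 0 < √3 := by positivity
  refine ⟨fun i hi => ?_, fun i hi => ?_⟩
  · rw [baseTriangle, if_neg ((normal_eq_iff a f i).1 hi)]
    split_ifs
    · exact Or.inl rfl
    · exact Or.inr rfl
  · rw [baseTriangle, if_pos (not_not.1 fun h => hi ((normal_eq_iff a f i).2 h))]
    simp

theorem exists_isPlacement_isBased (f : Face) (a : Fin 3) :
    ∃ s, IsPlacement f s ∧ IsBased f (across a f) s := by
  by_cases h : ∏ i, normal f i = 1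
  · exact ⟨_, isPlacement_baseTriangle (l := a + 1) ((by decide : ∀ a : Fin 3, a + 1 ≠ a) a)
      (by simp [h]), isBased_baseTriangle _ _ _⟩
  · exact ⟨_, isPlacement_baseTriangle (l := a + 2) ((by decide : ∀ a : Fin 3, a + 2 ≠ a) a)
      (by simp only [h, iff_false]; exact (by decide : ∀ a : Fin 3, a + 2 ≠ a + 1) a),
      isBased_baseTriangle _ _ _⟩

theorem exists_isOrientation {u : Face} {w : List (Fin 3)} (hw : (walk u w).Nodup) :
    ∃ t, IsOrientation (pathGraph (walk u w)) u (across 0 u) t := by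
  obtain ⟨s, hs, hb⟩ := exists_isPlacement_isBased u 0
  obtain ⟨t, h1, h2, h3⟩ := exists_unfolding hw hs
  exact ⟨t, mem_walk_self u w, adj_across 0 u, by rwa [h1], h2, h3⟩

/-! ### Paths without repeated letters unfold to convex strips -/

/-- The barycentric coordinates with respect to the triangle reflected at the edge opposite to the
`i`-th vertex. -/
def rebase (i : Fin 3) (c : Fin 3 → ℝ) (j : Fin 3) : ℝ := if j = i then -c i else c j + c i

theorem rebase_rebase (i : Fin 3) (c : Fin 3 → ℝ) : rebase i (rebase i c) = c := by
  funext j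
  by_cases h : j = i <;> simp [rebase, h]

theorem sum_rebase_smul (i : Fin 3) (c : Fin 3 → ℝ) (t : Fin 3 → Plane) :
    ∑ j, rebase i c j • reflect i t j = ∑ j, c j • t j := by
  rw [Fin.sum_univ_three, Fin.sum_univ_three]
  fin_cases i <;> simp [rebase, reflect] <;> module

theorem sum_rebase (i : Fin 3) (c : Fin 3 → ℝ) : ∑ j, rebase i c j = ∑ j, c j := by
  rw [Fin.sum_univ_three, Fin.sum_univ_three]
  fin_cases i <;> simp [rebase] <;> ring

/-- The point with barycentric coordinates `c` lies in one of the triangles obtained by rolling the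
triangle of reference along a word. -/
def Covered : List (Fin 3) → (Fin 3 → ℝ) → Prop
  | [], c => ∀ i, 0 ≤ c i
  | i :: w, c => (∀ i, 0 ≤ c i) ∨ Covered w (rebase i c)

/-- The barycentric coordinates, with respect to the triangle of reference, of the point which has
the coordinates `c` with respect to the last triangle. -/
def pullback : List (Fin 3) → (Fin 3 → ℝ) → Fin 3 → ℝ
  | [], c => c
  | i :: w, c => rebase i (pullback w c)

theorem sum_pullback (w : List (Fin 3)) (c : Fin 3 → ℝ) : ∑ j, pullback w c j = ∑ j, c j := by
  induction w with
  | nil => rfl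
  | cons i w ih => rw [pullback, sum_rebase, ih]

theorem sum_pullback_smul (w : List (Fin 3)) (c : Fin 3 → ℝ) (t : Fin 3 → Plane) :
    ∑ j, pullback w c j • t j = ∑ j, c j • unfold w t j := by
  induction w generalizing t with
  | nil => rfl
  | cons i w ih => rw [unfold, ← ih, pullback, ← sum_rebase_smul i (rebase i _), rebase_rebase]

theorem mem_image_of_covered {H : DualGraph} {f g : Face} {t : Face → Fin 3 → Plane}
    (ht : IsOrientation H f g t) {u : Face} {w : List (Fin 3)} (h : pathGraph (walk u w) ≤ H)
    {c : Fin 3 → ℝ} (hc : ∑ i, c i = 1) (hw : Covered w c) : ∑ i, c i • t u i ∈ image H t := by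
  induction w generalizing u c with
  | nil => exact Set.mem_iUnion₂.2 ⟨u, h.1 (mem_walk_self u []), sum_smul_mem_image _ _ hw hc⟩
  | cons i w ih =>
    rcases hw with hw | hw
    · exact Set.mem_iUnion₂.2 ⟨u, h.1 (mem_walk_self u _), sum_smul_mem_image _ _ hw hc⟩
    · have h1 : pathGraph (walk u [i]) ≤ H :=
        (pathGraph_mono (walk_prefix u (by simp)).isInfix).trans h
      have h2 : t (across i u) = reflect i (t u) := ht.eq_unfold h1
      rw [← sum_rebase_smul i, ← h2]
      exact ih ((pathGraph_tail_le u i w).trans h) (by rw [sum_rebase, hc]) hw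

theorem exists_third {a b : Fin 3} (h : a ≠ b) : ∃ c, c ≠ a ∧ c ≠ b := by
  revert a b; decide

theorem forall_fin_three {a b c : Fin 3} (hab : a ≠ b) (hac : a ≠ c) (hbc : b ≠ c)
    {P : Fin 3 → Prop} : (∀ i, P i) ↔ P a ∧ P b ∧ P c := by
  have : ∀ a b c : Fin 3, a ≠ b → a ≠ c → b ≠ c → ∀ i, i = a ∨ i = b ∨ i = c := by decide
  refine ⟨fun h => ⟨h a, h b, h c⟩, fun ⟨ha, hb, hc⟩ i => ?_⟩
  rcases this a b c hab hac hbc i with rfl | rfl | rfl <;> assumption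

theorem sum_fin_three {a b c : Fin 3} (hab : a ≠ b) (hac : a ≠ c) (hbc : b ≠ c)
    (d : Fin 3 → ℝ) : ∑ i, d i = d a + d b + d c := by
  have : ∀ a b c : Fin 3, a ≠ b → a ≠ c → b ≠ c → Finset.univ = {a, b, c} := by decide
  rw [this a b c hab hac hbc, Finset.sum_insert (by simp [hab, hac]), Finset.sum_pair hbc, add_assoc]

/-- The triangles along a path without repeated letters form a triangle, a rhombus, a trapezoid or
a parallelogram, and so the segment between points of the first and the last of them is covered. -/
theorem covered_of_nodup {w : List (Fin 3)} (hw : w.Nodup) {c d : Fin 3 → ℝ} (hc : ∀ i, 0 ≤ c i)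
    (hc1 : ∑ i, c i = 1) (hd : ∀ i, 0 ≤ d i) (hd1 : ∑ i, d i = 1) {x y : ℝ} (hx : 0 ≤ x)
    (hy : 0 ≤ y) (hxy : x + y = 1) : Covered w fun i => x * c i + y * pullback w d i := by
  have h3 := length_le_of_nodup hw
  have low : ∀ {m A B : ℝ}, m ≤ A → m ≤ B → m ≤ x * A + y * B := fun {m A B} hA hB => by
    linear_combination x * hA + y * hB - m * hxy
  have upp : ∀ {m A B : ℝ}, A ≤ m → B ≤ m → x * A + y * B ≤ m := fun {m A B} hA hB => by
    linear_combination x * hA + y * hB + m * hxy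
  obtain ⟨e, he⟩ : ∃ e, e = fun i => x * c i + y * pullback w d i := ⟨_, rfl⟩
  have e1 : ∑ i, e i = 1 := by
    rw [he, Finset.sum_add_distrib, ← Finset.mul_sum, ← Finset.mul_sum, sum_pullback, hc1, hd1]
    linarith
  have he' := fun i => congrFun he i
  rw [← he]
  clear he
  -- with the coordinates `e` of the point, the strip of the word `a` is `0 ≤ e b, e z ≤ 1`, that of
  -- `a b` is `0 ≤ e b ≤ 1, 0 ≤ e z, -1 ≤ e a`, and that of `a b z` is `0 ≤ e b ≤ 1, 0 ≤ e z ≤ 2`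
  rcases w with _ | ⟨a, _ | ⟨b, _ | ⟨z, _ | ⟨d, w⟩⟩⟩⟩
  · intro i
    rw [he']
    exact low (hc i) (hd i)
  · obtain ⟨b, hb, -⟩ := exists_third ((by decide : ∀ a : Fin 3, a ≠ a + 1) a)
    obtain ⟨z, hz, hzb⟩ := exists_third hb
    rw [sum_fin_three hb.symm hzb.symm hz.symm] at *
    have ca := hc a
    have cb := hc b
    have cz := hc z
    have da := hd a
    have db := hd b
    have dz := hd z
    have b0 : 0 ≤ e b := by
      rw [he']; simp only [pullback, rebase, hb, if_false]
      exact low cb (by linarith)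
    have b1 : e b ≤ 1 := by
      rw [he']; simp only [pullback, rebase, hb, if_false]
      exact upp (by linarith) (by linarith)
    have z0 : 0 ≤ e z := by
      rw [he']; simp only [pullback, rebase, hzb, if_false]
      exact low cz (by linarith)
    have z1 : e z ≤ 1 := by
      rw [he']; simp only [pullback, rebase, hzb, if_false]
      exact upp (by linarith) (by linarith)
    simp only [Covered, forall_fin_three hb.symm hzb.symm hz.symm, rebase, hb, hzb, if_true,
      if_false]
    rcases le_total 0 (e a) with h | h
    · left
      refine ⟨h, ?_, ?_⟩ <;> linarith
    · right
      refine ⟨?_, ?_, ?_⟩ <;> linarith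
  · have hab : a ≠ b := by simpa using hw
    obtain ⟨z, hza, hzb⟩ := exists_third hab
    rw [sum_fin_three hab hza.symm hzb.symm] at *
    have ca := hc a
    have cb := hc b
    have cz := hc z
    have da := hd a
    have db := hd b
    have dz := hd z
    have b0 : 0 ≤ e b := by
      rw [he']; simp only [pullback, rebase, hab, hab.symm, if_true, if_false]
      exact low cb (by linarith)
    have b1 : e b ≤ 1 := by
      rw [he']; simp only [pullback, rebase, hab, hab.symm, if_true, if_false]
      exact upp (by linarith) (by linarith)
    have z0 : 0 ≤ e z := by
      rw [he']; simp only [pullback, rebase, hab, hza, hzb, if_false]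
      exact low cz (by linarith)
    have a0 : -1 ≤ e a := by
      rw [he']; simp only [pullback, rebase, hab, if_true, if_false]
      exact low (by linarith) (by linarith)
    simp only [Covered, forall_fin_three hab hza.symm hzb.symm, rebase, hab, hab.symm, hza, hzb,
      if_true, if_false]
    rcases le_total 0 (e a) with h | h
    · left
      refine ⟨h, ?_, ?_⟩ <;> linarith
    rcases le_total (e z) 1 with h' | h'
    · right; left
      refine ⟨?_, ?_, ?_⟩ <;> linarith
    · right; right
      refine ⟨?_, ?_, ?_⟩ <;> linarith
  · obtain ⟨hab, haz, hbz⟩ : a ≠ b ∧ a ≠ z ∧ b ≠ z := by simpa [and_assoc] using hw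
    rw [sum_fin_three hab haz hbz] at *
    have ca := hc a
    have cb := hc b
    have cz := hc z
    have da := hd a
    have db := hd b
    have dz := hd z
    have b0 : 0 ≤ e b := by
      rw [he']; simp only [pullback, rebase, hab, hab.symm, haz, hbz, if_true, if_false]
      exact low cb (by linarith)
    have b1 : e b ≤ 1 := by
      rw [he']; simp only [pullback, rebase, hab, hab.symm, haz, hbz, if_true, if_false]
      exact upp (by linarith) (by linarith)
    have z0 : 0 ≤ e z := by
      rw [he']
      simp only [pullback, rebase, hab, haz, hbz, haz.symm, hbz.symm, if_true, if_false]
      exact low cz (by linarith)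
    have z2 : e z ≤ 2 := by
      rw [he']
      simp only [pullback, rebase, hab, haz, hbz, haz.symm, hbz.symm, if_true, if_false]
      exact upp (by linarith) (by linarith)
    simp only [Covered, forall_fin_three hab haz hbz, rebase, hab, hab.symm, haz, hbz, haz.symm,
      hbz.symm, if_true, if_false]
    rcases le_total 0 (e a) with h | h
    · left
      refine ⟨h, ?_, ?_⟩ <;> linarith
    rcases le_total (e z) 1 with h' | h'
    · right; left
      refine ⟨?_, ?_, ?_⟩ <;> linarith
    rcases le_total (-1) (e a) with h'' | h''
    · right; right; left
      refine ⟨?_, ?_, ?_⟩ <;> linarith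
    · right; right; right
      refine ⟨?_, ?_, ?_⟩ <;> linarith
  · simp at h3; omega

/-- The trail in a landscape without repeated letters has the length of the chord, because the
unfolded landscape is convex. -/
theorem trailLength_le_chord {u : Face} {w x : List (Fin 3)} (hw : w.Nodup) (hx : (walk u x).Nodup)
    (hwx : pathGraph (walk u w) ≤ pathGraph (walk u x))
    {p q : Space} (hp : p ∈ region u) (hq : q ∈ region (walkEnd u w)) :
    trailLength (pathGraph (walk u x)) p q ≤ ENNReal.ofReal (chord u w p q) := by
  obtain ⟨t, ht⟩ := exists_isOrientation hx
  refine sInf_le ⟨u, _, t, ht, u, mem_walk_self u x, walkEnd u w, hwx.1 (walkEnd_mem_walk u w),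
    hp, hq, ?_, (ht.edist_eq hwx hp hq).symm⟩
  obtain ⟨hp0, hp1⟩ := mem_region_iff.1 hp
  obtain ⟨hq0, hq1⟩ := mem_region_iff.1 hq
  rintro _ ⟨a, b, ha, hb, hab, rfl⟩
  rw [ht.eq_unfold hwx, place_eq, place_eq, ← sum_pullback_smul, Finset.smul_sum, Finset.smul_sum,
    ← Finset.sum_add_distrib]
  simp only [smul_smul, ← add_smul]
  refine mem_image_of_covered ht hwx ?_ (covered_of_nodup hw hp0 hp1 hq0 hq1 ha hb hab)
  rw [Finset.sum_add_distrib, ← Finset.mul_sum, ← Finset.mul_sum, sum_pullback, hp1, hq1]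
  linarith

/-! ### Nets -/

/-- Up to an additive constant, `f` is the `m`-th barycentric coordinate with respect to `t`. -/
theorem exists_separating_functional {t : Fin 3 → Plane} (ht : signedArea t ≠ 0) (m : Fin 3) :
    ∃ f : Plane →L[ℝ] ℝ, Function.Surjective f ∧
      ∀ i, i ≠ m → f (t m) = f (t i) + 1 := by
  obtain ⟨f, hf⟩ : ∃ f : Plane →L[ℝ] ℝ, ∀ z, f z = ((t (m + 2) 0 - t (m + 1) 0) * z 1 -
      (t (m + 2) 1 - t (m + 1) 1) * z 0) / signedArea t := by
    refine ⟨((t (m + 2) 0 - t (m + 1) 0) / signedArea t) • EuclideanSpace.proj 1 -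
      ((t (m + 2) 1 - t (m + 1) 1) / signedArea t) • EuclideanSpace.proj 0, fun z => ?_⟩
    simp
    ring
  have h : ∀ i, i ≠ m → f (t m) = f (t i) + 1 := by
    intro i hi
    rw [hf, hf, div_add_one ht]
    congr 1
    fin_cases m <;> fin_cases i <;> simp [signedArea] at hi ⊢ <;> ring
  refine ⟨f, fun r => ⟨r • (t m - t (m + 1)), ?_⟩, h⟩
  rw [map_smul, map_sub, h (m + 1) ((by decide : ∀ m : Fin 3, m + 1 ≠ m) m)]
  simp

/-- Two triangles of the triangular lattice spanned by `t` have disjoint interiors if they are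
separated by a coordinate. -/
theorem disjoint_interior {t : Fin 3 → Plane} (ht : signedArea t ≠ 0) {w x : List (Fin 3)}
    {m : Fin 3} (h : ∀ i j, unfold w unitFrame i m ≤ unfold x unitFrame j m) :
    Disjoint (interior (convexHull ℝ (Set.range (unfold w t))))
      (interior (convexHull ℝ (Set.range (unfold x t)))) := by
  obtain ⟨f, hf, hfm⟩ := exists_separating_functional ht m
  have hval : ∀ (w : List (Fin 3)) j,
      f (unfold w t j) = f (t m) - 1 + unfold w unitFrame j m := fun w j => by
    have hs := (unfold_unitFrame w).1 j
    have hs' : ∑ l, (unfold w unitFrame j l : ℝ) = 1 := by exact_mod_cast hs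
    rw [unfold_eq_combination w t j, map_sum]
    simp only [map_smul, smul_eq_mul]
    have h3 : ∀ l, f (t l) = f (t m) - 1 + if l = m then 1 else 0 := fun l => by
      split_ifs with hl
      · rw [hl]; ring
      · rw [hfm l hl]; ring
    rw [Finset.sum_congr rfl fun l _ => by rw [h3 l, mul_add], Finset.sum_add_distrib,
      ← Finset.sum_mul, hs']
    simp
  obtain ⟨i, hi⟩ := Finite.exists_max fun i => unfold w unitFrame i m
  have hw : convexHull ℝ (Set.range (unfold w t)) ⊆ f ⁻¹' Set.Iic (f (unfold w t i)) := by
    refine convexHull_min ?_ ((convex_Iic _).linear_preimage f.toLinearMap)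
    rintro _ ⟨j, rfl⟩
    have := hi j
    simp only [Set.mem_preimage, Set.mem_Iic, hval]
    gcongr
  have hx : convexHull ℝ (Set.range (unfold x t)) ⊆ f ⁻¹' Set.Ici (f (unfold w t i)) := by
    refine convexHull_min ?_ ((convex_Ici _).linear_preimage f.toLinearMap)
    rintro _ ⟨j, rfl⟩
    have := h i j
    simp only [Set.mem_preimage, Set.mem_Ici, hval]
    gcongr
  have hw' := interior_mono hw
  have hx' := interior_mono hx
  rw [f.interior_preimage hf, interior_Iic] at hw'
  rw [f.interior_preimage hf, interior_Ici] at hx'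
  refine Set.disjoint_left.2 fun z h1 h2 => ?_
  have h3 : f z < f (unfold w t i) := hw' h1
  have h4 : f (unfold w t i) < f z := hx' h2
  exact lt_asymm h3 h4

theorem reachable_of_mem_walk {H : DualGraph} {u : Face} {w : List (Fin 3)}
    (h : pathGraph (walk u w) ≤ H) {f : Face} (hf : f ∈ walk u w) :
    H.spanningCoe.Reachable u f := by
  induction w generalizing u with
  | nil => rw [List.mem_singleton.1 hf]
  | cons i w ih =>
    rcases List.mem_cons.1 hf with rfl | hf
    · exact SimpleGraph.Reachable.refl _
    · have h1 : H.spanningCoe.Adj u (across i u) := h.2 (pathGraph_adj_cons u i w)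
      exact h1.reachable.trans (ih ((pathGraph_tail_le u i w).trans h) hf)

theorem ncard_edgeSet_pathGraph (u : Face) (w : List (Fin 3)) :
    (pathGraph (walk u w)).spanningCoe.edgeSet.ncard ≤ w.length := by
  induction w generalizing u with
  | nil =>
    have : (pathGraph (walk u [])).spanningCoe.edgeSet = ∅ := by
      rw [SimpleGraph.edgeSet_eq_empty]
      ext k l
      simp only [SimpleGraph.Subgraph.spanningCoe_adj, SimpleGraph.bot_adj, iff_false]
      rintro ⟨-, h | h⟩ <;> simpa [walk] using h.length_le
    simp [this]
  | cons i w ih =>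
    have : (pathGraph (walk u (i :: w))).spanningCoe.edgeSet ⊆
        insert s(u, across i u) (pathGraph (walk (across i u) w)).spanningCoe.edgeSet := by
      intro e
      induction e with
      | h k l =>
        intro h
        have h : (pathGraph (walk u (i :: w))).Adj k l := h
        rcases pathGraph_adj_cases h with ⟨hk, hl⟩ | ⟨hl, hk⟩ | h
        · exact Or.inl (by rw [hk, hl])
        · exact Or.inl (by rw [hk, hl, Sym2.eq_swap])
        · exact Or.inr h
    calc _ ≤ _ := Set.ncard_le_ncard this (Set.toFinite _)
      _ ≤ _ := Set.ncard_insert_le _ _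
      _ ≤ _ := by simpa using ih _

theorem isTree_pathGraph {u : Face} {w : List (Fin 3)} (hw : w.length = 7)
    (h : ∀ f, f ∈ walk u w) : (pathGraph (walk u w)).spanningCoe.IsTree := by
  have hc : (pathGraph (walk u w)).spanningCoe.Connected :=
    SimpleGraph.connected_iff_exists_forall_reachable _ |>.2
      ⟨u, fun f => reachable_of_mem_walk le_rfl (h f)⟩
  rw [SimpleGraph.isTree_iff_connected_and_card]
  refine ⟨hc, ?_⟩
  have h1 := hc.card_vert_le_card_edgeSet_add_one
  have h2 := ncard_edgeSet_pathGraph u w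
  have h3 : Nat.card Face = 8 := by rw [Nat.card_eq_fintype_card]; rfl
  rw [← Nat.card_coe_set_eq] at h2
  omega

/-- The path `a b c b a b c` through all faces is the dual graph of a net. Every word without
repeated letters is the beginning of such a word, and so it gives a landscape. -/
theorem isNet_pathGraph (u : Face) {a b c : Fin 3} (h : [a, b, c].Nodup) :
    IsNet (pathGraph (walk u [a, b, c, b, a, b, c])) := by
  have hall : ∀ (u : Face) (a b c : Fin 3), [a, b, c].Nodup →
      ∀ f, f ∈ walk u [a, b, c, b, a, b, c] := by decide +kernel
  have hnodup : ∀ (u : Face) (a b c : Fin 3), [a, b, c].Nodup →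
      (walk u [a, b, c, b, a, b, c]).Nodup := by decide +kernel
  -- any two triangles of this unfolding are separated by a line of the triangular lattice
  have hsep : ∀ a b c : Fin 3, [a, b, c].Nodup → ∀ w ∈ [a, b, c, b, a, b, c].inits,
      ∀ x ∈ [a, b, c, b, a, b, c].inits, w ≠ x → ∃ m,
        (∀ i j, unfold w unitFrame i m ≤ unfold x unitFrame j m) ∨
        ∀ i j, unfold x unitFrame i m ≤ unfold w unitFrame j m := by decide +kernel
  obtain ⟨t, ht⟩ := exists_isOrientation (hnodup u a b c h)
  refine ⟨hall u a b c h, isTree_pathGraph rfl (hall u a b c h), _, _, t, ht, fun k l hkl => ?_⟩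
  obtain ⟨w, hw, rfl⟩ := exists_prefix_of_mem_walk (hall u a b c h k)
  obtain ⟨x, hx, rfl⟩ := exists_prefix_of_mem_walk (hall u a b c h l)
  rw [ht.eq_unfold (pathGraph_mono (walk_prefix u hw).isInfix),
    ht.eq_unfold (pathGraph_mono (walk_prefix u hx).isInfix)]
  have harea : signedArea (t u) ≠ 0 := by
    have := (ht.placement u (mem_walk_self u _)).exterior_up
    intro h0
    simp [h0] at this
  obtain ⟨m, h1 | h1⟩ := hsep a b c h w ((List.mem_inits _ _).2 hw) x ((List.mem_inits _ _).2 hx)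
    fun h => hkl (h ▸ rfl)
  · exact disjoint_interior harea h1
  · exact (disjoint_interior harea h1).symm

theorem isLandscapeFromTo_of_nodup (u : Face) {w : List (Fin 3)} (hw : w.Nodup) (h0 : w ≠ []) :
    IsLandscapeFromTo (pathGraph (walk u w)) u (walkEnd u w) := by
  have key : ∀ w ∈ shortWords, ∃ a b c, [a, b, c].Nodup ∧ w <+: [a, b, c, b, a, b, c] := by
    decide +kernel
  obtain ⟨a, b, c, h1, h2⟩ := key w (mem_shortWords.2 hw)
  refine ⟨⟨walk u w, nodup_walk_of_nodup u hw, isChain_walk u w, ?_, head?_walk u w,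
    getLast?_walk u w, rfl⟩, _, isNet_pathGraph u h1, pathGraph_mono (walk_prefix u h2).isInfix⟩
  have := List.length_pos_of_ne_nil h0
  rw [length_walk]
  omega

theorem IsLandscapeFromTo.exists_walk {H : DualGraph} {u v : Face} (h : IsLandscapeFromTo H u v) :
    ∃ w, (walk u w).Nodup ∧ w ≠ [] ∧ walkEnd u w = v ∧ H = pathGraph (walk u w) := by
  obtain ⟨⟨l, h1, h2, h3, h4, h5, rfl⟩, -⟩ := h
  obtain ⟨l, rfl⟩ : ∃ l', l = u :: l' := by
    cases l with
    | nil => simp at h4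
    | cons a l => simp at h4; exact ⟨l, by rw [h4]⟩
  obtain ⟨w, hw⟩ := Octahedron.exists_walk h2
  rw [hw] at h1 h3 h5 ⊢
  refine ⟨w, h1, ?_, ?_, rfl⟩
  · rintro rfl
    simp [walk] at h3
  · rw [getLast?_walk] at h5
    exact Option.some.inj h5

/-! ### Landscapes which cross a coordinate plane twice are not valid -/

theorem mem_points {H : DualGraph} {p : Space} : p ∈ points H ↔ ∃ f ∈ H.verts, p ∈ region f := by
  simp [points]

theorem chord_radicand_nonneg {u : Face} {w : List (Fin 3)} {p q : Space} (hp : p ∈ region u)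
    (hq : q ∈ region (walkEnd u w)) : 0 ≤ meanSq w (bary u p) (bary (walkEnd u w) q) -
      spread (bary u p) - spread (bary (walkEnd u w) q) := by
  obtain ⟨s, hs, -⟩ := exists_isPlacement_isBased u 0
  rw [← dist_sq_unfold hs.unit w (mem_region_iff.1 hp).2 (mem_region_iff.1 hq).2]
  positivity

theorem chord_lt_chord {u : Face} {w x : List (Fin 3)} {p q : Space} (hp : p ∈ region u)
    (hq : q ∈ region (walkEnd u w)) (hx : walkEnd u x = walkEnd u w)
    (h : meanSq x (bary u p) (bary (walkEnd u w) q) < meanSq w (bary u p) (bary (walkEnd u w) q)) :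
    ENNReal.ofReal (chord u x p q) < ENNReal.ofReal (chord u w p q) := by
  have h0 := chord_radicand_nonneg hp (hx ▸ hq : q ∈ region (walkEnd u x))
  have : chord u x p q < chord u w p q := by
    refine Real.sqrt_lt_sqrt h0 ?_
    rw [hx]
    linarith
  exact (ENNReal.ofReal_lt_ofReal_iff ((Real.sqrt_nonneg _).trans_lt this)).2 this

/-- The strict inequality needs the first point off the first edge crossed, and the second point off
the last one. -/
theorem exists_meanSq_lt {u : Face} {w : List (Fin 3)} (hw : (walk u w).Nodup) (hn : ¬ w.Nodup)
    {c d : Fin 3 → ℝ} (hc : ∀ i, 0 ≤ c i) (hd : ∀ i, 0 ≤ d i) {a b : Fin 3} (ha : a ∈ w.head?)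
    (hb : b ∈ w.getLast?) (hca : c a ≠ 0) (hdb : d b ≠ 0) :
    ∃ x, x.Nodup ∧ walkEnd u x = walkEnd u w ∧ meanSq x c d < meanSq w c d := by
  obtain ⟨x, y, hx, hy, hxe, hye, hle, hlt⟩ := exists_dominated hw hn
  have key : 0 < ∑ i, ∑ j, c i * d j * (2 * sqTable w i j - sqTable x i j - sqTable y i j : ℤ) := by
    have h0 : ∀ i j, 0 ≤ c i * d j * (2 * sqTable w i j - sqTable x i j - sqTable y i j : ℤ) :=
      fun i j => mul_nonneg (mul_nonneg (hc i) (hd j)) (by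
        have := hle i j
        exact_mod_cast (by omega : 0 ≤ 2 * sqTable w i j - sqTable x i j - sqTable y i j))
    refine Finset.sum_pos' (fun i _ => Finset.sum_nonneg fun j _ => h0 i j)
      ⟨a, Finset.mem_univ _, Finset.sum_pos' (fun j _ => h0 a j) ⟨b, Finset.mem_univ _, ?_⟩⟩
    refine mul_pos (mul_pos ((hc a).lt_of_ne' hca) ((hd b).lt_of_ne' hdb)) ?_
    have := hlt a ha b hb
    exact_mod_cast (by omega : 0 < 2 * sqTable w a b - sqTable x a b - sqTable y a b)
  have hsum : meanSq x c d + meanSq y c d < 2 * meanSq w c d := by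
    push_cast at key
    simp only [mul_sub, mul_left_comm _ (2 : ℝ), Finset.sum_sub_distrib, ← Finset.mul_sum] at key
    unfold meanSq
    linarith
  by_cases h : meanSq x c d < meanSq w c d
  · exact ⟨x, hx, hxe, h⟩
  · exact ⟨y, hy, hye, by linarith⟩

/-- A path `walk v x` with a repeated letter has a competitor for every pair of points: given images
of the points under an unfolding of the path, there is another landscape with a trail of at most the
distance of these images, which is shorter or belongs to a part of the path. -/
theorem exists_competitor {v : Face} {x : List (Fin 3)} (hx : (walk v x).Nodup) (hn : ¬ x.Nodup)
    {f g : Face} {t : Face → Fin 3 → Plane} (ht : IsOrientation (pathGraph (walk v x)) f g t)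
    {p q : Space} (n : ℕ) : ∀ (u : Face) (w : List (Fin 3)), w.length = n → (walk u w).Nodup →
      pathGraph (walk u w) ≤ pathGraph (walk v x) → p ∈ region u → q ∈ region (walkEnd u w) →
      ∃ K, IsLandscape K ∧ K ≠ pathGraph (walk v x) ∧ p ∈ points K ∧ q ∈ points K ∧
        trailLength K p q ≤ edist (place u (t u) p) (place (walkEnd u w) (t (walkEnd u w)) q) ∧
        (trailLength K p q < edist (place u (t u) p) (place (walkEnd u w) (t (walkEnd u w)) q) ∨
          K ≤ pathGraph (walk v x)) := by
  -- `p` and `q` lie in the faces of `K = walk u y`, whose chord along a prefix `w` is the trail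
  have build : ∀ {u : Face} {w y : List (Fin 3)}, y.Nodup → y ≠ [] → w <+: y → p ∈ region u →
      q ∈ region (walkEnd u w) → IsLandscape (pathGraph (walk u y)) ∧
        pathGraph (walk u y) ≠ pathGraph (walk v x) ∧ p ∈ points (pathGraph (walk u y)) ∧
        q ∈ points (pathGraph (walk u y)) ∧
        trailLength (pathGraph (walk u y)) p q ≤ ENNReal.ofReal (chord u w p q) := by
    intro u w y hy hy0 hwy hp hq
    have hle := pathGraph_mono (walk_prefix u hwy).isInfix
    exact ⟨⟨_, _, isLandscapeFromTo_of_nodup u hy hy0⟩, pathGraph_ne hy hx hn,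
      mem_points.2 ⟨u, mem_walk_self u y, hp⟩,
      mem_points.2 ⟨walkEnd u w, hle.1 (walkEnd_mem_walk u w), hq⟩,
      trailLength_le_chord (hwy.sublist.nodup hy) (nodup_walk_of_nodup u hy) hle hp hq⟩
  induction n with
  | zero =>
    intro u w hw _ hle hp hq
    obtain rfl := List.length_eq_zero_iff.1 hw
    rw [ht.edist_eq hle hp hq]
    have hu : u ∈ walk v x := hle.1 (mem_walk_self u [])
    -- both points lie in `u`, and so in any pair of adjacent faces of the path that contains `u`
    obtain ⟨l, hl, hlu⟩ : ∃ l ∈ walk v x, l ≠ u := by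
      cases x with
      | nil => simp at hn
      | cons j x =>
        have hv : v ≠ across j v := fun h =>
          (List.nodup_cons.1 hx).1 (h ▸ mem_walk_self (across j v) x)
        by_cases hvu : v = u
        · exact ⟨across j v, List.mem_cons_of_mem _ (mem_walk_self _ _), hvu ▸ hv.symm⟩
        · exact ⟨v, mem_walk_self _ _, hvu⟩
    obtain ⟨y, hy, -, hyle⟩ := exists_subwalk hx hu hl
    cases y with
    | nil => exact absurd hy.symm hlu
    | cons i y =>
      obtain ⟨h1, h2, h3, h4, h5⟩ := build (u := u) (w := []) (y := [i]) (by simp) (by simp)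
        List.nil_prefix hp hq
      exact ⟨_, h1, h2, h3, h4, h5, Or.inr
        ((pathGraph_mono (walk_prefix u (by simp)).isInfix).trans hyle)⟩
  | succ n ih =>
    intro u w hw hwn hle hp hq
    by_cases hs : w.Nodup
    · obtain ⟨h1, h2, h3, h4, h5⟩ := build hs (by rintro rfl; simp at hw) List.prefix_rfl hp hq
      rw [ht.edist_eq hle hp hq]
      exact ⟨_, h1, h2, h3, h4, h5, Or.inr hle⟩
    obtain ⟨a, w', rfl⟩ := List.exists_cons_of_length_eq_add_one hw
    -- a point on the first or last edge crossed allows to shorten the path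
    by_cases ha : bary u p a = 0
    · have h := ih (across a u) w' (by simpa using hw) (List.nodup_cons.1 hwn).2
        ((pathGraph_tail_le u a w').trans hle) (mem_region_across hp ha) hq
      rwa [place_across (ht.glue _ _ (hle.2 (pathGraph_adj_cons u a w'))) ha] at h
    obtain ⟨w₀, b, hb⟩ : ∃ w₀ b, a :: w' = w₀ ++ [b] :=
      ⟨_, _, (List.dropLast_append_getLast (List.cons_ne_nil a w')).symm⟩
    have he : walkEnd u (a :: w') = across b (walkEnd u w₀) := by
      rw [hb, walkEnd_append]; rfl
    by_cases hqb : bary (walkEnd u (a :: w')) q b = 0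
    · have hadj := hle.2 (hb ▸ pathGraph_adj_last u w₀ b)
      rw [← he] at hadj
      have he' : walkEnd u w₀ = across b (walkEnd u (a :: w')) := by rw [he, across_across]
      have hq' := mem_region_across hq hqb
      have hl : pathGraph (walk u w₀) ≤ pathGraph (walk u (a :: w')) := by
        rw [hb]; exact pathGraph_init_le u w₀ b
      have hpre : w₀ <+: a :: w' := ⟨[b], hb.symm⟩
      have h := ih u w₀ (by have := congrArg List.length hb; simp at this hw; omega)
        ((walk_prefix u hpre).sublist.nodup hwn) (hl.trans hle) hp (by rwa [he'])
      rw [he'] at h hadj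
      rwa [place_across (ht.glue _ _ hadj.symm) hqb] at h
    · obtain ⟨y, hy, hye, hlt⟩ := exists_meanSq_lt hwn hs (mem_region_iff.1 hp).1
        (mem_region_iff.1 hq).1 (a := a) (b := b) rfl (by simp [hb]) ha hqb
      have hlt' := chord_lt_chord hp hq hye hlt
      have hy0 : y ≠ [] := by
        rintro rfl
        have h : walkEnd (across a u) w' ∈ walk (across a u) w' := walkEnd_mem_walk _ _
        rw [← show u = walkEnd (across a u) w' from hye] at h
        exact (List.nodup_cons.1 hwn).1 h
      obtain ⟨h1, h2, h3, h4, h5⟩ := build hy hy0 List.prefix_rfl hp (hye ▸ hq)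
      rw [ht.edist_eq hle hp hq]
      exact ⟨_, h1, h2, h3, h4, h5.trans hlt'.le, Or.inl (h5.trans_lt hlt')⟩

/-- A valid landscape crosses no coordinate plane twice: otherwise the trail would be shorter than
each of the finitely many segments of which it is the shortest. -/
theorem nodup_of_witnesses {v : Face} {x : List (Fin 3)} (hx : (walk v x).Nodup) {p q : Space}
    (h : Witnesses (pathGraph (walk v x)) p q) : x.Nodup := by
  by_contra hn
  obtain ⟨hp, hq, hK⟩ := h
  have key : ∀ f g t, IsOrientation (pathGraph (walk v x)) f g t → ∀ k ∈ walk v x, ∀ l ∈ walk v x,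
      p ∈ region k → q ∈ region l → trailLength (pathGraph (walk v x)) p q <
        edist (place k (t k) p) (place l (t l) q) := by
    intro f g t ht k hk l hl hpk hql
    obtain ⟨w, rfl, hw, hle⟩ := exists_subwalk hx hk hl
    obtain ⟨K, h1, h2, h3, h4, h5, h6⟩ := exists_competitor hx hn ht _ k w rfl hw hle hpk hql
    obtain ⟨h7, h8⟩ := hK K h1 h2 h3 h4
    rcases h6 with h6 | h6
    · exact h7.trans_lt h6
    · exact (lt_of_le_of_ne h7 fun h => h8 h h6).trans_le h5
  obtain ⟨k₀, hk₀, hpk₀⟩ := mem_points.1 hp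
  obtain ⟨l₀, hl₀, hql₀⟩ := mem_points.1 hq
  choose! W hW using fun k (hk : k ∈ walk v x) l (hl : l ∈ walk v x) => exists_subwalk hx hk hl
  -- the lengths of the segments form a finite set, so that their infimum is one of them
  have hmem : trailLength (pathGraph (walk v x)) p q ∈ {d | ∃ f g t,
      IsOrientation (pathGraph (walk v x)) f g t ∧ ∃ k ∈ (pathGraph (walk v x)).verts,
      ∃ l ∈ (pathGraph (walk v x)).verts, p ∈ region k ∧ q ∈ region l ∧
      segment ℝ (place k (t k) p) (place l (t l) q) ⊆ image (pathGraph (walk v x)) t ∧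
      d = edist (place k (t k) p) (place l (t l) q)} := by
    refine Set.Nonempty.csInf_mem ?_ ((Set.finite_range fun kl : Face × Face =>
      ENNReal.ofReal (chord kl.1 (W kl.1 kl.2) p q)).subset ?_)
    · by_contra hempty
      rw [Set.not_nonempty_iff_eq_empty] at hempty
      obtain ⟨t, ht⟩ := exists_isOrientation hx
      have := key _ _ t ht k₀ hk₀ l₀ hl₀ hpk₀ hql₀
      rw [trailLength, hempty, sInf_empty] at this
      exact not_top_lt this
    · rintro _ ⟨f, g, t, ht, k, hk, l, hl, hpk, hql, -, rfl⟩
      obtain ⟨h1, -, h3⟩ := hW k hk l hl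
      refine ⟨(k, l), ?_⟩
      have := ht.edist_eq h3 hpk (h1.symm ▸ hql)
      rw [h1] at this
      exact this.symm
  obtain ⟨f, g, t, ht, k, hk, l, hl, hpk, hql, -, hd⟩ := hmem
  exact (key f g t ht k hk l hl hpk hql).ne hd

/-! ### The witnesses -/

/-- The word of the landscape `L_{a+1}`. -/
def word : Fin 9 → List (Fin 3) :=
  ![[2], [2, 0], [0, 2], [0, 2, 1], [2, 1, 0], [1, 0, 2], [0, 1, 2], [2, 0, 1], [1, 2, 0]]

theorem faces_eq_walk (a : Fin 9) : faces a = walk F1 (word a) := by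
  revert a; decide

theorem word_nodup (a : Fin 9) : (word a).Nodup := by revert a; decide

theorem word_ne_nil (a : Fin 9) : word a ≠ [] := by revert a; decide

theorem exists_eq_word {a : Fin 9} {x : List (Fin 3)} (hx : x.Nodup)
    (h : walkEnd F1 x = walkEnd F1 (word a)) : ∃ b, x = word b := by
  have : ∀ x ∈ shortWords, ∀ a, walkEnd F1 x = walkEnd F1 (word a) → ∃ b, x = word b := by
    decide +kernel
  exact this x (mem_shortWords.2 hx) a h

/-- The barycentric coordinates of the point with coordinates `(x, y)` in an equilateral triangle
with the vertices `(0,0)`, `(1,0)` and `(1/2, √3/2)`. -/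
noncomputable def triangleCoords (x y : ℝ) : Fin 3 → ℝ :=
  ![1 - x - y * √3 / 3, x - y * √3 / 3, 2 * y * √3 / 3]

/-- The barycentric coordinates of the first point for `L_{a+1}`, numbered as the vertices
of `F1`. -/
noncomputable def firstCoords (a : Fin 9) : Fin 3 → ℝ :=
  triangleCoords (firstPoint a).2.2.1 (firstPoint a).2.2.2

/-- The barycentric coordinates of the second point for `L_{a+1}`, numbered as the vertices of its
home-face. On `F2` and on `F8` the vertices `0, 1, 2` are in clockwise order, and so the roles of
`0` and `1` are exchanged. -/
noncomputable def secondCoords (a : Fin 9) (i : Fin 3) : ℝ :=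
  triangleCoords (secondPoint a).2.2.1 (secondPoint a).2.2.2
    (if a = 1 ∨ a = 2 then i else Equiv.swap 0 1 i)

theorem sqrt_three_bounds : √3 * √3 = 3 ∧ 1.732 < √3 ∧ √3 < 1.7321 := by
  refine ⟨Real.mul_self_sqrt (by norm_num), ?_, ?_⟩
  · rw [Real.lt_sqrt (by norm_num)]; norm_num
  · rw [Real.sqrt_lt' (by norm_num)]; norm_num

theorem firstCoords_pos (a : Fin 9) (i : Fin 3) : 0 < firstCoords a i := by
  obtain ⟨-, h1, h2⟩ := sqrt_three_bounds
  fin_cases a <;> fin_cases i <;> simp [firstCoords, triangleCoords, firstPoint] <;>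
    norm_num <;> linarith

theorem secondCoords_pos (a : Fin 9) (i : Fin 3) : 0 < secondCoords a i := by
  obtain ⟨-, h1, h2⟩ := sqrt_three_bounds
  fin_cases a <;> fin_cases i <;>
    simp [secondCoords, triangleCoords, secondPoint, Equiv.swap_apply_def] <;>
    norm_num <;> linarith

set_option maxHeartbeats 4000000 in
/-- For the two points given for `L_{a+1}`, every other of the nine paths with the same ends has a
longer chord. -/
theorem meanSq_word_lt {a b : Fin 9} (hab : a ≠ b)
    (h : walkEnd F1 (word b) = walkEnd F1 (word a)) :
    meanSq (word a) (firstCoords a) (secondCoords a) <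
      meanSq (word b) (firstCoords a) (secondCoords a) := by
  obtain ⟨h3, h1, h2⟩ := sqrt_three_bounds
  -- this leaves the pairs of different words with the same end
  fin_cases a <;> fin_cases b <;>
    try (first | (exact absurd rfl hab) | (exact absurd h (by decide)))
  all_goals clear h hab
  all_goals
    simp [meanSq, Fin.sum_univ_three, sqTable, unfold, reflect, unitFrame, word, firstCoords,
      firstPoint, secondCoords, secondPoint, triangleCoords, Equiv.swap_apply_def]
    linarith

theorem sum_triangleCoords (x y : ℝ) : ∑ i, triangleCoords x y i = 1 := by
  simp [triangleCoords, Fin.sum_univ_three]; ring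

theorem sum_firstCoords (a : Fin 9) : ∑ i, firstCoords a i = 1 := sum_triangleCoords _ _

theorem sum_secondCoords (a : Fin 9) : ∑ i, secondCoords a i = 1 := by
  unfold secondCoords
  split_ifs
  · exact sum_triangleCoords _ _
  · rw [Equiv.sum_comp (Equiv.swap 0 1) (triangleCoords _ _), sum_triangleCoords]

theorem meanSq_map (σ : Equiv.Perm (Fin 3)) {w : List (Fin 3)} (hw : w.Nodup) (c d : Fin 3 → ℝ) :
    meanSq (w.map σ) c d = meanSq w (c ∘ σ) (d ∘ σ) := by
  unfold meanSq
  rw [← Equiv.sum_comp σ]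
  simp_rw [← Equiv.sum_comp σ (fun j => c _ * d j * (sqTable (w.map σ) _ j : ℝ)), sqTable_map σ hw]
  rfl

theorem map_symm_map (σ : Equiv.Perm (Fin 3)) (w : List (Fin 3)) :
    (w.map σ.symm).map σ = w := by
  simp [List.map_map]

/-- Among the paths with the ends of the given one, it alone has the shortest chord. -/
theorem meanSq_lt_of_ne (σ : Equiv.Perm (Fin 3)) (u : Face) (a : Fin 9) {c d : Fin 3 → ℝ}
    (hc : c ∘ σ = firstCoords a) (hd : d ∘ σ = secondCoords a) {x : List (Fin 3)}
    (hx : (walk u x).Nodup) (he : walkEnd u x = walkEnd u ((word a).map σ))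
    (hne : x ≠ (word a).map σ) : meanSq ((word a).map σ) c d < meanSq x c d := by
  have short : ∀ {x : List (Fin 3)}, x.Nodup → walkEnd u x = walkEnd u ((word a).map σ) →
      x ≠ (word a).map σ → meanSq ((word a).map σ) c d < meanSq x c d := by
    intro x hx he hne
    have hy : (x.map σ.symm).Nodup := hx.map σ.symm.injective
    rw [← map_symm_map σ x] at he hne ⊢
    rw [meanSq_map σ (word_nodup a), meanSq_map σ hy, hc, hd]
    have he' := (walkEnd_map_eq_iff σ hy (word_nodup a) u).1 he
    obtain ⟨b, hb⟩ := exists_eq_word hy he'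
    rw [hb] at he' hne ⊢
    exact meanSq_word_lt (fun h => hne (by rw [h])) he'
  by_cases hn : x.Nodup
  · exact short hn he hne
  have hc0 : ∀ i, 0 < c i := fun i => by
    have := congrFun hc (σ.symm i)
    rw [Function.comp_apply, Equiv.apply_symm_apply] at this
    exact this ▸ firstCoords_pos a _
  have hd0 : ∀ i, 0 < d i := fun i => by
    have := congrFun hd (σ.symm i)
    rw [Function.comp_apply, Equiv.apply_symm_apply] at this
    exact this ▸ secondCoords_pos a _
  have hx0 : x ≠ [] := by rintro rfl; simp at hn
  obtain ⟨y, hy, hye, hlt⟩ := exists_meanSq_lt hx hn (fun i => (hc0 i).le) (fun i => (hd0 i).le)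
    (List.head?_eq_some_head hx0) (List.getLast?_eq_some_getLast hx0) (hc0 _).ne' (hd0 _).ne'
  by_cases hyw : y = (word a).map σ
  · exact hyw ▸ hlt
  · exact (short hy (hye.trans he) hyw).trans hlt

theorem witnesses_of_coords (σ : Equiv.Perm (Fin 3)) (u : Face) (a : Fin 9) {p q : Space}
    (hc : bary u p ∘ σ = firstCoords a)
    (hd : bary (walkEnd u ((word a).map σ)) q ∘ σ = secondCoords a) :
    Witnesses (pathGraph (walk u ((word a).map σ))) p q := by
  obtain ⟨w, hw⟩ : ∃ w, w = (word a).map σ := ⟨_, rfl⟩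
  rw [← hw] at hd ⊢
  have hwn : w.Nodup := by rw [hw]; exact (word_nodup a).map σ.injective
  have hp0 : ∀ i, 0 < bary u p i := fun i => by
    have := congrFun hc (σ.symm i)
    rw [Function.comp_apply, Equiv.apply_symm_apply] at this
    exact this ▸ firstCoords_pos a _
  have hq0 : ∀ i, 0 < bary (walkEnd u w) q i := fun i => by
    have := congrFun hd (σ.symm i)
    rw [Function.comp_apply, Equiv.apply_symm_apply] at this
    exact this ▸ secondCoords_pos a _
  have hp : p ∈ region u := mem_region_iff.2 ⟨fun i => (hp0 i).le, by
    rw [← Equiv.sum_comp σ, ← sum_firstCoords a, ← hc]; rfl⟩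
  have hq : q ∈ region (walkEnd u w) := mem_region_iff.2 ⟨fun i => (hq0 i).le, by
    rw [← Equiv.sum_comp σ, ← sum_secondCoords a, ← hd]; rfl⟩
  refine ⟨mem_points.2 ⟨u, mem_walk_self u w, hp⟩, mem_points.2 ⟨_, walkEnd_mem_walk u w, hq⟩, ?_⟩
  rintro K ⟨k, l, hK⟩ hne hpK hqK
  obtain ⟨x, hx, -, -, rfl⟩ := hK.exists_walk
  obtain ⟨k', hk', hpk⟩ := mem_points.1 hpK
  obtain rfl := eq_of_mem_region hp0 hpk
  obtain ⟨l', hl', hql⟩ := mem_points.1 hqK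
  obtain rfl := eq_of_mem_region hq0 hql
  obtain ⟨y, hye, hy, hyle⟩ := exists_subwalk hx hk' hl'
  have hH : trailLength (pathGraph (walk k' w)) p q ≤ ENNReal.ofReal (chord k' w p q) :=
    trailLength_le_chord hwn (nodup_walk_of_nodup _ hwn) le_rfl hp hq
  -- `p` and `q` are interior points of their faces, so that all segments have the same length
  have hK' : ENNReal.ofReal (chord k' y p q) ≤ trailLength (pathGraph (walk k x)) p q := by
    refine le_sInf ?_
    rintro _ ⟨f, g, t, ht, m, hm, n, hn, hpm, hqn, -, rfl⟩
    obtain rfl := eq_of_mem_region hp0 hpm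
    obtain rfl := eq_of_mem_region hq0 hqn
    rw [← hye]
    exact (ht.edist_eq hyle hp (hye ▸ hq)).ge
  by_cases hyw : y = w
  · rw [hyw] at hK' hyle
    exact ⟨hH.trans hK', fun _ hle => hne (le_antisymm hle hyle)⟩
  · have hlt := meanSq_lt_of_ne σ k' a hc (hw ▸ hd) hy (hw ▸ hye) (hw ▸ hyw)
    rw [← hw, ← hye] at hlt
    have := hH.trans_lt ((chord_lt_chord hp (hye ▸ hq) hye.symm hlt).trans_le hK')
    exact ⟨this.le, fun h => absurd h this.ne⟩

theorem isRepresentation_of_coords {f : Face} {a l r : Fin 3} (hla : l ≠ a) (hra : r ≠ a)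
    (hlr : l ≠ r) (ho : l = a + 1 ↔ ∏ i, normal f i = 1) {p : Space} {x y : ℝ}
    (hp : p ∈ region f) (ha : bary f p a = 2 * y * √3 / 3)
    (hr : bary f p r = x - y * √3 / 3) : IsRepresentation p f (across a f) x y := by
  have h3 := Real.mul_self_sqrt (show (0:ℝ) ≤ 3 by norm_num)
  refine ⟨adj_across a f, hp, _, isPlacement_baseTriangle hla ho, isBased_baseTriangle f a l, ?_⟩
  have hs : place f (baseTriangle a l) p = bary f p a • baseTriangle a l a +
      bary f p l • baseTriangle a l l + bary f p r • baseTriangle a l r := by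
    have : ∀ a l r : Fin 3, l ≠ a → r ≠ a → l ≠ r → Finset.univ = {a, l, r} := by decide
    rw [place_eq, this a l r hla hra hlr, Finset.sum_insert (by simp [hla.symm, hra.symm]),
      Finset.sum_pair hlr, add_assoc]
  rw [hs, ha, hr]
  ext m
  fin_cases m
  · simp [baseTriangle, hla, hra, hlr.symm]
    ring
  · simp [baseTriangle, hla, hra, hlr.symm]
    linear_combination y / 3 * h3

/-! ### Labellings -/

/-- The face which is reached from `u` by crossing the coordinate planes `σ i` for those `i` for
which `f` and `F1` are on different sides of the coordinate plane `i`. -/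
def relabel (u : Face) (σ : Equiv.Perm (Fin 3)) (f : Face) : Face :=
  (if normal f 0 = 1 then id else across (σ 0)) ((if normal f 1 = 1 then id else across (σ 1))
    ((if normal f 2 = 1 then id else across (σ 2)) u))

theorem relabel_across (u : Face) (σ : Equiv.Perm (Fin 3)) (i : Fin 3) (f : Face) :
    relabel u σ (across i f) = across (σ i) (relabel u σ f) := by
  revert u σ i f; decide +kernel

theorem relabel_injective (u : Face) (σ : Equiv.Perm (Fin 3)) :
    Function.Injective (relabel u σ) := by
  have : ∀ (u : Face) (σ : Equiv.Perm (Fin 3)) (f g : Face),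
      relabel u σ f = relabel u σ g → f = g := by decide +kernel
  exact fun f g => this u σ f g

/-- The permutation `σ` of the coordinates respects the orientation, when `F1` is moved to `u`. -/
def Oriented (u : Face) (σ : Equiv.Perm (Fin 3)) : Prop :=
  σ 0 = σ 2 + 1 ↔ ∏ i, normal u i = 1

instance (u : Face) (σ : Equiv.Perm (Fin 3)) : Decidable (Oriented u σ) :=
  inferInstanceAs (Decidable (_ ↔ _))

theorem isClockwise_iff {f a b c : Face} : IsClockwise f a b c ↔
    faceGraph.Adj f a ∧ faceGraph.Adj f b ∧ faceGraph.Adj f c ∧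
      normal a 0 * normal b 1 * normal c 2 - normal a 0 * normal b 2 * normal c 1 -
        normal a 1 * normal b 0 * normal c 2 + normal a 1 * normal b 2 * normal c 0 +
        normal a 2 * normal b 0 * normal c 1 - normal a 2 * normal b 1 * normal c 0 < 0 := by
  rw [IsClockwise, Matrix.det_fin_three]
  rfl

instance (f a b c : Face) : Decidable (IsClockwise f a b c) :=
  decidable_of_iff' _ isClockwise_iff

instance (f g : Face) : Decidable (IsOpposite f g) :=
  inferInstanceAs (Decidable (∀ i, normal f i ≠ normal g i))

theorem exists_isLabelling {u : Face} {σ : Equiv.Perm (Fin 3)} (h : Oriented u σ) :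
    ∃ n : Equiv.Perm Face, IsLabelling n ∧ ∀ f, n f = relabel u σ f := by
  refine ⟨Equiv.ofBijective _ (Finite.injective_iff_bijective.1 (relabel_injective u σ)),
    ?_, fun _ => rfl⟩
  have : ∀ (u : Face) (σ : Equiv.Perm (Fin 3)), Oriented u σ →
      IsClockwise (relabel u σ F1) (relabel u σ F2) (relabel u σ F4) (relabel u σ F6) ∧
      IsOpposite (relabel u σ F1) (relabel u σ F8) ∧ IsOpposite (relabel u σ F2) (relabel u σ F7) ∧
      IsOpposite (relabel u σ F3) (relabel u σ F6) ∧
      IsOpposite (relabel u σ F4) (relabel u σ F5) := by decide +kernel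
  obtain ⟨h1, h2, h3, h4, h5⟩ := this u σ h
  exact ⟨h1, h2, h3, h4, h5⟩

theorem IsLabelling.exists_relabel {n : Equiv.Perm Face} (h : IsLabelling n) :
    ∃ σ, Oriented (n F1) σ ∧ ∀ f, n f = relabel (n F1) σ f := by
  have hc : ∀ u a b c : Face, IsClockwise u a b c → ∃ σ : Equiv.Perm (Fin 3), Oriented u σ ∧
      a = relabel u σ F2 ∧ b = relabel u σ F4 ∧ c = relabel u σ F6 := by decide +kernel
  have ho : ∀ f g, IsOpposite f g → f = across 0 (across 1 (across 2 g)) := by decide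
  have ho' : ∀ f g, IsOpposite f g → g = across 0 (across 1 (across 2 f)) := by decide
  obtain ⟨σ, hσ, h2, h4, h6⟩ := hc _ _ _ _ h.clockwise
  refine ⟨σ, hσ, fun f => ?_⟩
  have h8 := ho' _ _ h.opp18
  have h7 := ho' _ _ h.opp27
  have h3 := ho _ _ h.opp36
  have h5 := ho' _ _ h.opp45
  rw [h2] at h7
  rw [h6] at h3
  rw [h4] at h5
  have key : ∀ (u : Face) (σ : Equiv.Perm (Fin 3)), u = relabel u σ F1 ∧
      across 0 (across 1 (across 2 u)) = relabel u σ F8 ∧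
      across 0 (across 1 (across 2 (relabel u σ F2))) = relabel u σ F7 ∧
      across 0 (across 1 (across 2 (relabel u σ F6))) = relabel u σ F3 ∧
      across 0 (across 1 (across 2 (relabel u σ F4))) = relabel u σ F5 := by decide +kernel
  obtain ⟨k1, k8, k7, k3, k5⟩ := key (n F1) σ
  cases f
  · exact k1
  · exact h2
  · exact h3.trans k3
  · exact h4
  · exact h5.trans k5
  · exact h6
  · exact h7.trans k7
  · exact h8.trans k8

theorem map_walk_relabel (u v : Face) (σ : Equiv.Perm (Fin 3)) (w : List (Fin 3)) :
    (walk v w).map (relabel u σ) = walk (relabel u σ v) (w.map σ) := by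
  induction w generalizing v with
  | nil => rfl
  | cons i w ih => rw [walk, List.map_cons, ih, List.map_cons, walk, relabel_across]

theorem walkEnd_relabel (u v : Face) (σ : Equiv.Perm (Fin 3)) (w : List (Fin 3)) :
    walkEnd (relabel u σ v) (w.map σ) = relabel u σ (walkEnd v w) := by
  induction w generalizing v with
  | nil => rfl
  | cons i w ih => rw [walkEnd, List.map_cons, walkEnd, ← relabel_across, ih]

/-! ### The landscapes between two faces -/

theorem landscape_eq {n : Equiv.Perm Face} {σ : Equiv.Perm (Fin 3)}
    (hσ : ∀ f, n f = relabel (n F1) σ f) (a : Fin 9) :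
    landscape n a = pathGraph (walk (n F1) ((word a).map σ)) := by
  rw [landscape, faces_eq_walk, show (⇑n : Face → Face) = relabel (n F1) σ from funext hσ,
    map_walk_relabel, ← hσ F1]

theorem landscape_injective (n : Equiv.Perm Face) : Function.Injective (landscape n) := by
  intro a b h
  have hmem : ∀ f, f ∈ faces a ↔ f ∈ faces b := fun f => by
    have : n f ∈ (landscape n a).verts ↔ n f ∈ (landscape n b).verts := by rw [h]
    simpa [landscape, mem_verts_pathGraph] using this
  have : ∀ a b, (∀ f, f ∈ faces a ↔ f ∈ faces b) → a = b := by decide +kernel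
  exact this a b hmem

theorem isLandscapeFromTo_landscape {n : Equiv.Perm Face} {σ : Equiv.Perm (Fin 3)}
    (hσ : ∀ f, n f = relabel (n F1) σ f) (a : Fin 9) :
    IsLandscapeFromTo (landscape n a) (n F1) (n (walkEnd F1 (word a))) := by
  rw [landscape_eq hσ, hσ (walkEnd F1 (word a)), ← walkEnd_relabel, ← hσ F1]
  exact isLandscapeFromTo_of_nodup _ ((word_nodup a).map σ.injective) (by simp [word_ne_nil])

theorem exists_witnesses {n : Equiv.Perm Face} {σ : Equiv.Perm (Fin 3)} (ho : Oriented (n F1) σ)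
    (hσ : ∀ f, n f = relabel (n F1) σ f) (a : Fin 9) :
    ∃ p q : Space, HasRepresentation n p (firstPoint a) ∧ HasRepresentation n q (secondPoint a) ∧
      Witnesses (landscape n a) p q := by
  obtain ⟨v, hv⟩ : ∃ v, v = walkEnd (n F1) ((word a).map σ) := ⟨_, rfl⟩
  obtain ⟨p, hp⟩ : ∃ p, bary (n F1) p = firstCoords a ∘ σ.symm := ⟨_, bary_sum_vertex _ _⟩
  obtain ⟨q, hq⟩ : ∃ q, bary v q = secondCoords a ∘ σ.symm := ⟨_, bary_sum_vertex _ _⟩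
  have hp' : ∀ i, bary (n F1) p (σ i) = firstCoords a i := fun i => by simp [hp]
  have hq' : ∀ i, bary v q (σ i) = secondCoords a i := fun i => by simp [hq]
  have hpr : p ∈ region (n F1) := by
    refine mem_region_iff.2 ⟨fun i => ?_, ?_⟩
    · rw [hp]; exact (firstCoords_pos a _).le
    · rw [← Equiv.sum_comp σ, ← sum_firstCoords a]
      exact Finset.sum_congr rfl fun i _ => hp' i
  have hqr : q ∈ region v := by
    refine mem_region_iff.2 ⟨fun i => ?_, ?_⟩
    · rw [hq]; exact (secondCoords_pos a _).le
    · rw [← Equiv.sum_comp σ, ← sum_secondCoords a]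
      exact Finset.sum_congr rfl fun i _ => hq' i
  have h20 : σ 0 ≠ σ 2 := σ.injective.ne (by decide)
  have h21 : σ 1 ≠ σ 2 := σ.injective.ne (by decide)
  have h01 : σ 0 ≠ σ 1 := σ.injective.ne (by decide)
  refine ⟨p, q, ?_, ?_, ?_⟩
  · have hf : (firstPoint a).1 = F1 ∧ (firstPoint a).2.1 = across 2 F1 := by
      fin_cases a <;> exact ⟨rfl, rfl⟩
    rw [HasRepresentation, hf.1, hf.2, hσ (across 2 F1), relabel_across, ← hσ]
    exact isRepresentation_of_coords h20 h21 h01 ho hpr (hp' 2) (hp' 1)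
  · have hf : (secondPoint a).1 = walkEnd F1 (word a) ∧
        (secondPoint a).2.1 = across 2 (walkEnd F1 (word a)) := by
      fin_cases a <;> exact ⟨rfl, rfl⟩
    have hn : n (walkEnd F1 (word a)) = v := by
      rw [hσ, ← walkEnd_relabel, ← hσ F1, hv]
    rw [HasRepresentation, hf.1, hf.2, hσ (across 2 _), relabel_across, ← hσ, hn]
    have key : ∀ (u : Face) (σ : Equiv.Perm (Fin 3)), Oriented u σ → ∀ a,
        (σ (if a = 1 ∨ a = 2 then 0 else 1) = σ 2 + 1 ↔
          ∏ i, normal (walkEnd u ((word a).map σ)) i = 1) := by decide +kernel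
    have ho' := key _ σ ho a
    rw [← hv] at ho'
    by_cases h : a = 1 ∨ a = 2
    · rw [if_pos h] at ho'
      refine isRepresentation_of_coords h20 h21 h01 ho' hqr ?_ ?_
      · rw [hq' 2, secondCoords, if_pos h]; rfl
      · rw [hq' 1, secondCoords, if_pos h]; rfl
    · rw [if_neg h] at ho'
      refine isRepresentation_of_coords h21 h20 h01.symm ho' hqr ?_ ?_
      · rw [hq' 2, secondCoords, if_neg h]; rfl
      · rw [hq' 0, secondCoords, if_neg h]; rfl
  · rw [landscape_eq hσ]
    exact witnesses_of_coords σ _ a (funext hp') (by rw [← hv]; exact funext hq')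

theorem IsLandscapeFromTo.exists_nodup {H : DualGraph} {u v : Face} (h : IsLandscapeFromTo H u v)
    (hv : IsValid H) : ∃ w, w.Nodup ∧ w ≠ [] ∧ walkEnd u w = v ∧ H = pathGraph (walk u w) := by
  obtain ⟨w, hw, h0, hwv, rfl⟩ := h.exists_walk
  obtain ⟨-, p, q, hpq⟩ := hv
  exact ⟨w, nodup_of_witnesses hw hpq, h0, hwv, rfl⟩

theorem valid_eq_image {n : Equiv.Perm Face} {σ : Equiv.Perm (Fin 3)} (ho : Oriented (n F1) σ)
    (hσ : ∀ f, n f = relabel (n F1) σ f) {v : Face}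
    (hv : ∃ a, walkEnd F1 (word a) = v) :
    {H | IsValid H ∧ IsLandscapeFromTo H (n F1) (n v)} =
      landscape n '' {a | walkEnd F1 (word a) = v} := by
  ext H
  constructor
  · rintro ⟨hH, h⟩
    obtain ⟨w, hw, -, hwv, rfl⟩ := h.exists_nodup hH
    obtain ⟨b, rfl⟩ := hv
    have hy : (w.map σ.symm).Nodup := hw.map σ.symm.injective
    rw [hσ (walkEnd F1 (word b)), ← walkEnd_relabel, ← hσ F1, ← map_symm_map σ w,
      walkEnd_map_eq_iff σ hy (word_nodup b)] at hwv
    obtain ⟨a, ha⟩ := exists_eq_word hy hwv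
    refine ⟨a, by rw [Set.mem_ofPred_eq, ← ha]; exact hwv, ?_⟩
    rw [landscape_eq hσ, ← ha, map_symm_map]
  · rintro ⟨a, rfl, rfl⟩
    have hl := isLandscapeFromTo_landscape hσ a
    obtain ⟨p, q, -, -, hpq⟩ := exists_witnesses ho hσ a
    exact ⟨⟨⟨_, _, hl⟩, p, q, hpq⟩, hl⟩

end Octahedron

theorem mainTheorem2 :
    (∀ n : Equiv.Perm Face, IsLabelling n →
      -- the nine landscapes are different and valid, with explicit witnesses
      Function.Injective (landscape n) ∧
      (∀ a : Fin 9, IsValid (landscape n a) ∧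
        ∃ p q : Space,
          HasRepresentation n p (firstPoint a) ∧
          HasRepresentation n q (secondPoint a) ∧
          Witnesses (landscape n a) p q) ∧
      -- they are the valid landscapes between the faces in question
      {H | IsValid H ∧ IsLandscapeFromTo H (n .F1) (n .F2)} =
        landscape n '' {0} ∧
      {H | IsValid H ∧ IsLandscapeFromTo H (n .F1) (n .F5)} =
        landscape n '' {1, 2} ∧
      {H | IsValid H ∧ IsLandscapeFromTo H (n .F1) (n .F8)} =
        landscape n '' {3, 4, 5, 6, 7, 8} ∧
      {H | IsValid H ∧
          (IsLandscapeFromTo H (n .F1) (n .F2) ∨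
            IsLandscapeFromTo H (n .F1) (n .F5) ∨
            IsLandscapeFromTo H (n .F1) (n .F8))}.ncard = 9) ∧
    -- up to the labelling of the faces, there are no other valid landscapes
    (∀ (H : DualGraph) (u v : Face),
      IsValid H → IsLandscapeFromTo H u v →
      ∃ n : Equiv.Perm Face, IsLabelling n ∧ n .F1 = u ∧
        ∃ a : Fin 9, H = landscape n a) := by
  refine ⟨fun n hn => ?_, fun H u v hH h => ?_⟩
  · obtain ⟨σ, ho, hσ⟩ := hn.exists_relabel
    have e2 := valid_eq_image ho hσ (v := .F2) ⟨0, rfl⟩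
    have e5 := valid_eq_image ho hσ (v := .F5) ⟨1, rfl⟩
    have e8 := valid_eq_image ho hσ (v := .F8) ⟨3, rfl⟩
    rw [show {a | walkEnd .F1 (word a) = .F2} = {0} by ext a; revert a; decide] at e2
    rw [show {a | walkEnd .F1 (word a) = .F5} = {1, 2} by ext a; revert a; decide] at e5
    rw [show {a | walkEnd .F1 (word a) = .F8} = {3, 4, 5, 6, 7, 8} by
      ext a; revert a; decide] at e8
    refine ⟨landscape_injective n, fun a => ?_, e2, e5, e8, ?_⟩
    · obtain ⟨p, q, hp, hq, hpq⟩ := exists_witnesses ho hσ a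
      exact ⟨⟨⟨_, _, isLandscapeFromTo_landscape hσ a⟩, p, q, hpq⟩, p, q, hp, hq, hpq⟩
    · have hall : {H | IsValid H ∧ (IsLandscapeFromTo H (n .F1) (n .F2) ∨
          IsLandscapeFromTo H (n .F1) (n .F5) ∨ IsLandscapeFromTo H (n .F1) (n .F8))} =
          landscape n '' Set.univ := by
        simp only [and_or_left, Set.ofPred_or]
        rw [e2, e5, e8, ← Set.image_union, ← Set.image_union]
        congr 1
        ext a; revert a; decide
      rw [hall, Set.ncard_image_of_injective _ (landscape_injective n), Set.ncard_univ,
        Nat.card_fin]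
  · obtain ⟨w, hw, h0, -, rfl⟩ := h.exists_nodup hH
    have key : ∀ w ∈ shortWords, w ≠ [] → ∀ u : Face, ∃ σ : Equiv.Perm (Fin 3), Oriented u σ ∧
        ∃ a, w = (word a).map σ := by decide +kernel
    obtain ⟨σ, ho, a, rfl⟩ := key w (mem_shortWords.2 hw) h0 u
    obtain ⟨n, hn, hσ⟩ := exists_isLabelling ho
    have hu : n .F1 = u := by rw [hσ]; rfl
    refine ⟨n, hn, hu, a, ?_⟩
    rw [landscape_eq (by rwa [hu]), hu]
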